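/- Let $(X,\mu)$ be a non-atomic standard probability space, and let $\mathrm{Aut}(L^\infty(X))$ denote the group of all $*$-automorphisms of the von Neumann algebra $L^\infty(X)=L^\infty(X,\mu;\mathbb{C})$. Let $\Gamma=\mathbb{Z}^2\rtimes\mathrm{SL}(2,\mathbb{Z})$, where $\mathrm{SL}(2,\mathbb{Z})$ acts on $\mathbb{Z}^2$ by matrix multiplication. For every non-trivial countable abelian group $H$ (finite or infinite, with the discrete topology) there exists a set of cardinality $2^{\aleph_0}$ of actions $\beta_c:\Gamma\to\mathrm{Aut}(L^\infty(X))$ such that: 1. each $\beta_c$ preserves the trace $f\mapsto\int_X f\,d\mu$, is essentially free (every $\gamma\neq e$ acts as $f\mapsto f\circ T^{-1}$ for a $\mu$-preserving Borel isomorphism $T$ of $X$ with $\mu(\{x: Tx=x\})=0$), and is ergodic (the only $\beta_c$-invariant elements of $L^\infty(X)$ are the scalars); 2. the $\beta_c$ are mutually non-conjugate: if $c\neq d$, there is no $*$-automorphism $\pi$ of $L^\infty(X)$, trace preserving or not, such that $\pi\circ\beta_c(\gamma)=\beta_d(\gamma)\circ\pi$ for all $\gamma\in\Gamma$; 3. for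 each $c$, the centralizer $\mathrm{Aut}(L^\infty(X),\beta_c)=\{\alpha\in\mathrm{Aut}(L^\infty(X)) : \alpha\circ\beta_c(\gamma)=\beta_c(\gamma)\circ\alpha \text{ for all }\gamma\in\Gamma\}$, with the topology of pointwise convergence in the $2$-norm $\|f\|_2=(\int_X|f|^2\,d\mu)^{1/2}$, is isomorphic as a topological group to $H\rtimes\mathrm{Aut}(H)$. Here $\mathrm{Aut}(H)$ acts on $H$ tautologically, and the topology on $H\rtimes\mathrm{Aut}(H)$ is the product of the discrete topology on $H$ and the topology of pointwise convergence on $\mathrm{Aut}(H)$. -/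

import Mathlib

open MeasureTheory
open scoped ENNReal

namespace TwistedBernoulli

/-! ### The group `ℤ² ⋊ SL(2, ℤ)` -/

/-- `SL(2, ℤ)` acting on the (multiplicatively written) group `ℤ²` by matrix-vector
multiplication. -/
def slAction : Matrix.SpecialLinearGroup (Fin 2) ℤ →* MulAut (Multiplicative (Fin 2 → ℤ)) where
  toFun A := AddEquiv.toMultiplicative (Matrix.SpecialLinearGroup.toLin' A).toAddEquiv
  map_one' := by ext1 v; simp
  map_mul' A B := by ext1 v; simp

/-- The semidirect product `ℤ² ⋊ SL(2, ℤ)`. -/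
abbrev Z2SL2 : Type :=
  SemidirectProduct (Multiplicative (Fin 2 → ℤ)) (Matrix.SpecialLinearGroup (Fin 2) ℤ) slAction

/-! ### The `*`-algebra `L^∞(X)` and its automorphisms -/

section Linfty

variable {X : Type*} [MeasurableSpace X] {μ : Measure X}

/-- Pointwise (a.e.) multiplication on `L^∞(X, μ)`. -/
noncomputable instance instMulLinfty : Mul (Lp ℂ ∞ μ) where
  mul f g := (HSMul.hSMul f g : Lp ℂ ∞ μ)

theorem coeFn_mul_Linfty (f g : Lp ℂ ∞ μ) : ⇑(f * g) =ᵐ[μ] fun x => f x * g x :=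
  Lp.coeFn_lpSMul f g

/-- The group of all `*`-automorphisms of the von Neumann algebra `L^∞(X, μ)`; the addition, the
scalar multiplication and the `*`-operation (pointwise complex conjugation) are the standard ones
on `L^∞`, and the product is the pointwise one. -/
abbrev AutLinfty (μ : Measure X) : Type _ := Lp ℂ ∞ μ ≃⋆ₐ[ℂ] Lp ℂ ∞ μ

variable {G : Type*} [Group G]

/-- The action preserves the trace `f ↦ ∫ f dμ`. -/
def IsTracePreserving (β : G →* AutLinfty μ) : Prop :=
  ∀ (g : G) (f : Lp ℂ ∞ μ), ∫ x, β g f x ∂μ = ∫ x, f x ∂μ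

/-- The action is ergodic: every invariant element is a scalar multiple of `1`. -/
def IsErgodicAction (β : G →* AutLinfty μ) : Prop :=
  ∀ f : Lp ℂ ∞ μ, (∀ g : G, β g f = f) → ∃ c : ℂ, ⇑f =ᵐ[μ] fun _ => c

/-- The (trace-preserving) action is essentially free: every group element `g ≠ 1` acts by
`f ↦ f ∘ T⁻¹` for some measure-preserving Borel isomorphism `T` of `X` whose set of fixed points
is null. -/
def IsEssentiallyFree (β : G →* AutLinfty μ) : Prop :=
  ∀ g : G, g ≠ 1 → ∃ T : X ≃ᵐ X, MeasurePreserving T μ μ ∧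
    (∀ f : Lp ℂ ∞ μ, ⇑(β g f) =ᵐ[μ] fun x => f (T.symm x)) ∧ μ {x | T x = x} = 0

/-- Two actions are conjugate if some `*`-automorphism of `L^∞(X)` (not assumed to preserve the
trace) intertwines them. -/
def IsConjugate (β₁ β₂ : G →* AutLinfty μ) : Prop :=
  ∃ π : AutLinfty μ, ∀ (g : G) (f : Lp ℂ ∞ μ), π (β₁ g f) = β₂ g (π f)

/-- `Aut(L^∞(X), β)`: the group of all `*`-automorphisms that commute with the action `β`. -/
noncomputable def Centralizer (β : G →* AutLinfty μ) : Subgroup (AutLinfty μ) :=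
  Subgroup.centralizer (Set.range β)

/-- The inclusion `L^∞(X) ⊆ L²(X)` of a finite measure space. -/
noncomputable def toL2 [IsFiniteMeasure μ] (f : Lp ℂ ∞ μ) : Lp ℂ 2 μ :=
  ((Lp.memLp f).mono_exponent le_top).toLp f

/-- The pointwise-`2`-norm topology on `Aut(L^∞(X), β)`: a net `α_i` converges to `α` if and only
if `‖α_i(f) - α(f)‖₂ → 0` for every `f ∈ L^∞(X)`. -/
noncomputable instance instTopCentralizer [IsFiniteMeasure μ] (β : G →* AutLinfty μ) :
    TopologicalSpace (Centralizer β) :=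
  TopologicalSpace.induced
    (fun (α : Centralizer β) (f : Lp ℂ ∞ μ) => toL2 ((α : AutLinfty μ) f)) Pi.topologicalSpace

end Linfty

/-! ### The topological group `H ⋊ Aut(H)` -/

/-- The semidirect product `H ⋊ Aut(H)` for the tautological action of `Aut(H)` on `H`. -/
abbrev Hol (H : Type*) [Group H] : Type _ := SemidirectProduct H (MulAut H) (MonoidHom.id (MulAut H))

/-- The product of the discrete topology on `H` and the topology of pointwise convergence on
`Aut(H)` (that is, the one inherited from the product `H^H` of copies of the discrete
space `H`). -/
instance instTopHol (H : Type*) [Group H] : TopologicalSpace (Hol H) :=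
  letI : TopologicalSpace H := ⊥
  TopologicalSpace.induced
    (fun x : Hol H => ((x.left, fun h : H => x.right h) : H × (H → H))) inferInstance

end TwistedBernoulli

/-! Put B = ℤ × H with first projection p : B → ℤ, and let A = `sumZero B` be the countable group of
finitely supported functions ℤ² → B of sum zero. As A has an element of infinite order, its compact
dual with Haar measure is non-atomic, so X can be identified with it (`nonempty_fourierModel`). Thus
L^∞(X) carries characters u_a, a ∈ A, which form an orthonormal basis of L². For t in the circle, g
= (v, S) sends u_a to t^k u_{ga}, where g permutes the points of ℤ² affinely and k = Σ_x p((ga)(x))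
det(v, x) is the flux. This is an action because the defect of the cocycle identity is a determinant
constant in x, which sum zero kills (`flux_cocycle`). It is ergodic because nonzero elements of A
have infinite orbits, and free because fixed points of g lie in a level set of a character of
infinite order.

The heart is rigidity. Let π intertwine the actions for t and t', and consider the edge b·δ_0 −
b·δ_{(1,0)}. Shears fixing both endpoints force the Fourier support of its image onto the line
through them. Writing one side of a triangle as the sum of the other two shrinks this support to the
endpoints, so π maps the edge character to a multiple l of the edge character of some b'
(`intertwiner_char_edge`). Two triangles of opposite orientation then determine l and give t^{2p(b)}
= t'^{2p(b')} (`intertwiner_scalar`).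

If t = t' has infinite order, then l = 1 and p(b') = p(b), so π is induced by an automorphism of B
over p (`exists_addEquiv_of_commute`). These automorphisms are the maps (n, h) ↦ (n, n·h₀ + θ(h)),
that is, the group H ⋊ Aut(H) (`exists_holAut`). The topologies match because distinct characters
are at 2-norm distance at least 1.

If t and t' are conjugate parameters, then t² and t'² are integer powers of each other. For
irrational angles in (0, 1/4) this forces equality (`eq_of_anglePoint_sq`), and there are continuum
many such angles. -/

namespace TwistedBernoulli

/-! ### Isomorphism of non-atomic standard probability spaces -/

section Isomorphism

open ProbabilityTheory Set Filter Topology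

/-- The distribution function of a non-atomic probability measure on `ℝ` is continuous. -/
theorem continuous_cdf (μ : Measure ℝ) [IsProbabilityMeasure μ] [NullSingletonClass μ] :
    Continuous (cdf μ) := by
  rw [continuous_iff_continuousAt]
  intro x
  have h := (cdf μ).measure_singleton x
  rw [measure_cdf, measure_singleton] at h
  have h1 : Function.leftLim (cdf μ) x = cdf μ x := by
    refine le_antisymm ((monotone_cdf μ).leftLim_le le_rfl) ?_
    have := ENNReal.ofReal_eq_zero.1 h.symm
    linarith
  rw [(monotone_cdf μ).continuousAt_iff_leftLim_eq_rightLim, h1, (cdf μ).rightLim_eq]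

/-- The distribution function of a non-atomic probability measure pushes it to the uniform
distribution on `[0, 1]`. -/
theorem measurePreserving_cdf (μ : Measure ℝ) [IsProbabilityMeasure μ] [NullSingletonClass μ] :
    MeasurePreserving (cdf μ) μ (volume.restrict (Icc 0 1)) := by
  have hm : Measurable (cdf μ) := (continuous_cdf μ).measurable
  refine ⟨hm, ?_⟩
  have : IsProbabilityMeasure (μ.map (cdf μ)) := Measure.isProbabilityMeasure_map hm.aemeasurable
  have key : ∀ x, cdf μ x < 1 → ∀ c < cdf μ x, cdf μ ⁻¹' Iic c ⊆ Iic x := by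
    intro x _ c hc y hy
    by_contra hxy
    exact absurd ((monotone_cdf μ) (not_le.1 hxy).le) (not_le.2 (lt_of_le_of_lt hy hc))
  have surj : ∀ c ∈ Ioo (0 : ℝ) 1, ∃ x, cdf μ x = c := by
    intro c hc
    obtain ⟨a, ha⟩ := ((tendsto_cdf_atBot μ).eventually (gt_mem_nhds hc.1)).exists
    obtain ⟨b, hb⟩ := ((tendsto_cdf_atTop μ).eventually (lt_mem_nhds hc.2)).exists
    exact mem_range_of_exists_le_of_exists_ge (continuous_cdf μ) ⟨a, ha.le⟩ ⟨b, hb.le⟩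
  have val : ∀ c ∈ Ioo (0 : ℝ) 1, μ (cdf μ ⁻¹' Iic c) = ENNReal.ofReal c := by
    intro c hc
    apply le_antisymm
    -- The level set at height c may be a whole interval, so the upper bound comes from points x
    -- whose value d exceeds c slightly.
    · refine le_of_forall_gt_imp_ge_of_dense fun d hd => ?_
      by_cases hd1 : d < 1
      · lift d to NNReal using (hd1.trans ENNReal.one_lt_top).ne
        have hcd : c < d := by
          rw [← ENNReal.ofReal_coe_nnreal] at hd
          exact ((ENNReal.ofReal_lt_ofReal_iff_of_nonneg hc.1.le).1 hd)
        have hd1' : (d : ℝ) < 1 := by exact_mod_cast hd1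
        obtain ⟨x, hx⟩ := surj d ⟨hc.1.trans hcd, hd1'⟩
        calc μ (cdf μ ⁻¹' Iic c) ≤ μ (Iic x) :=
              measure_mono (key x (by rw [hx]; exact hd1') c (by rw [hx]; exact hcd))
          _ = d := by rw [← ofReal_cdf, hx, ENNReal.ofReal_coe_nnreal]
      · exact prob_le_one.trans (not_lt.1 hd1)
    · obtain ⟨x, hx⟩ := surj c hc
      rw [← hx, ofReal_cdf]
      exact measure_mono fun y hy => (monotone_cdf μ) hy
  refine Measure.ext_of_Iic _ _ fun c => ?_
  rw [Measure.map_apply hm measurableSet_Iic, Measure.restrict_apply measurableSet_Iic]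
  rcases le_or_gt c 0 with h0 | h0
  · have : Iic c ∩ Icc (0 : ℝ) 1 ⊆ {0} := fun y hy => le_antisymm (le_trans hy.1 h0) hy.2.1
    rw [measure_mono_null this (by simp)]
    refine le_antisymm (le_of_forall_gt_imp_ge_of_dense fun d hd => ?_) zero_le
    obtain ⟨e, he0, he1⟩ := ENNReal.lt_iff_exists_nnreal_btwn.1 (lt_min hd one_pos)
    have he0' : 0 < (e : ℝ) := by exact_mod_cast he0
    have he1' : (e : ℝ) < 1 := by exact_mod_cast he1.trans_le (min_le_right _ _)
    calc μ (cdf μ ⁻¹' Iic c) ≤ μ (cdf μ ⁻¹' Iic (e : ℝ)) :=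
          measure_mono (preimage_mono (Iic_subset_Iic.2 (h0.trans he0'.le)))
      _ = e := by rw [val _ ⟨he0', he1'⟩, ENNReal.ofReal_coe_nnreal]
      _ ≤ d := he1.le.trans (min_le_left _ _)
  rcases lt_or_ge c 1 with h1 | h1
  · have : Iic c ∩ Icc (0 : ℝ) 1 = Icc 0 c := by
      ext y; simp only [mem_inter_iff, mem_Iic, mem_Icc]
      constructor
      · rintro ⟨a, b, d⟩; exact ⟨b, a⟩
      · rintro ⟨a, b⟩; exact ⟨b, a, b.trans h1.le⟩
    rw [val c ⟨h0, h1⟩, this, Real.volume_Icc, sub_zero]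
  · have e1 : Iic c ∩ Icc (0 : ℝ) 1 = Icc 0 1 := inter_eq_right.2 fun y hy => hy.2.trans h1
    have e2 : cdf μ ⁻¹' Iic c = univ := eq_univ_of_forall fun y => (cdf_le_one μ y).trans h1
    rw [e1, e2]; simp

/-- A non-atomic probability space is uncountable. -/
theorem not_countable_of_nonatomic {X : Type*} [MeasurableSpace X] (μ : Measure X)
    [IsProbabilityMeasure μ] [NullSingletonClass μ] : ¬ Countable X := fun _ => by
  have := (countable_univ (α := X)).measure_zero μ
  simp at this

/-- An uncountable standard Borel space with a finite measure has an uncountable Borel null set. -/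
theorem exists_not_countable_null {X : Type*} [MeasurableSpace X] [StandardBorelSpace X]
    (μ : Measure X) [IsFiniteMeasure μ] (h : ¬ Countable X) :
    ∃ P : Set X, MeasurableSet P ∧ μ P = 0 ∧ ¬ P.Countable := by
  have hR : ¬ Countable (ℝ × ℝ) := fun hc =>
    Cardinal.not_countable_real (countable_univ_iff.2
      ((Prod.mk_right_injective (0 : ℝ)).countable))
  let e : X ≃ᵐ ℝ × ℝ := PolishSpace.measurableEquivOfNotCountable h hR
  -- The fibres over the first coordinate are uncountably many disjoint uncountable sets, and only
  -- countably many of them can have positive measure.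
  let F : ℝ → Set X := fun r => e ⁻¹' (Prod.fst ⁻¹' {r})
  have hF : ∀ r, MeasurableSet (F r) := fun r =>
    e.measurable (measurable_fst (measurableSet_singleton r))
  have hd : Pairwise (Function.onFun Disjoint F) := by
    intro r s hrs
    refine Set.disjoint_left.2 fun x hx hy => hrs ?_
    simp only [F, mem_preimage, mem_singleton_iff] at hx hy
    rw [← hx, ← hy]
  have hc := Measure.countable_meas_pos_of_disjoint_iUnion (μ := μ) hF hd
  obtain ⟨r, hr⟩ : ∃ r, ¬ 0 < μ (F r) := by
    by_contra hall
    push Not at hall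
    exact Cardinal.not_countable_real (hc.mono fun r _ => hall r)
  refine ⟨F r, hF r, nonpos_iff_eq_zero.1 (not_lt.1 hr), fun hcount => ?_⟩
  apply Cardinal.not_countable_real
  have : (univ : Set ℝ) ⊆ (fun x => (e x).2) '' F r := fun s _ =>
    ⟨e.symm (r, s), by simp [F], by simp⟩
  exact (hcount.image _).mono this

/-- A non-atomic standard probability space is isomorphic, by a Borel isomorphism, to `ℝ` with the
uniform distribution on `[0, 1]`. -/
theorem exists_measurableEquiv_real {X : Type*} [MeasurableSpace X] [StandardBorelSpace X]
    (μ : Measure X) [IsProbabilityMeasure μ] [NullSingletonClass μ] :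
    ∃ e : X ≃ᵐ ℝ, MeasurePreserving e μ (volume.restrict (Icc 0 1)) := by
  classical
  have hX : ¬ Countable X := not_countable_of_nonatomic μ
  have hR : ¬ Countable ℝ := fun h => Cardinal.not_countable_real (countable_univ_iff.2 h)
  let j : X ≃ᵐ ℝ := PolishSpace.measurableEquivOfNotCountable hX hR
  have hj : Measurable j := j.measurable
  have : IsProbabilityMeasure (μ.map j) := Measure.isProbabilityMeasure_map hj.aemeasurable
  have : NullSingletonClass (μ.map j) := ⟨fun r => by
    rw [Measure.map_apply hj (measurableSet_singleton r)]
    have : j ⁻¹' {r} = {j.symm r} := by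
      ext x; simp only [mem_preimage, mem_singleton_iff]; exact j.toEquiv.eq_symm_apply.symm
    rw [this, measure_singleton]⟩
  set F : X → ℝ := fun x => cdf (μ.map j) (j x)
  have hF : MeasurePreserving F μ (volume.restrict (Icc 0 1)) :=
    (measurePreserving_cdf (μ.map j)).comp (hj.measurePreserving μ)
  obtain ⟨P, hP, hP0, hPc⟩ := exists_not_countable_null μ hX
  -- If the distribution function takes the same value at two points, it takes that value at a
  -- rational between them. Removing the countably many values in D therefore makes F injective.
  -- Removing P as well leaves an uncountable null complement, to be matched with the complement of
  -- the image.
  let D : Set ℝ := range fun q : ℚ => cdf (μ.map j) q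
  have hD : D.Countable := countable_range _
  let G : Set X := F ⁻¹' Dᶜ ∩ Pᶜ
  have hG : MeasurableSet G := (hF.measurable hD.measurableSet.compl).inter hP.compl
  have hG0 : μ Gᶜ = 0 := by
    have : Gᶜ = F ⁻¹' D ∪ P := by simp [G, compl_inter]
    rw [this]
    refine measure_union_null ?_ hP0
    rw [hF.measure_preimage hD.measurableSet.nullMeasurableSet]
    exact hD.measure_zero _
  have hinj' : ∀ x ∈ G, ∀ y, j x < j y → F x ≠ F y := by
    intro x hx y hxy h
    obtain ⟨q, hq1, hq2⟩ := exists_rat_btwn hxy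
    refine hx.1 ⟨q, ?_⟩
    exact le_antisymm (((monotone_cdf (μ.map j)) hq2.le).trans h.symm.le)
      ((monotone_cdf (μ.map j)) hq1.le)
  have hinj : InjOn F G := by
    intro x hx y hy h
    by_contra hne
    rcases lt_or_gt_of_ne (fun h => hne (j.injective h) : j x ≠ j y) with hl | hl
    · exact hinj' x hx y hl h
    · exact hinj' y hy x hl h.symm
  have hemb : MeasurableEmbedding (fun x : G => F x) := by
    have : StandardBorelSpace G := hG.standardBorel
    exact (hF.measurable.comp measurable_subtype_coe).measurableEmbedding
      (fun x y h => Subtype.ext (hinj x.2 y.2 h))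
  set R : Set ℝ := range (fun x : G => F x)
  have hR' : MeasurableSet R := hemb.measurableSet_range
  have hGc : ¬ Countable (Gᶜ : Set X) := fun h =>
    hPc ((countable_coe_iff.1 h).mono (by simp [G, compl_inter]))
  have hRc : ¬ Countable (Rᶜ : Set ℝ) := fun h => by
    -- The target is all of ℝ with mass only on [0, 1], so the null complement of the image is
    -- automatically uncountable.
    have hsub : Ioo (1 : ℝ) 2 ⊆ Rᶜ := by
      rintro y hy ⟨x, rfl⟩
      exact absurd (cdf_le_one (μ.map j) (j x)) (not_le.2 hy.1)
    have h2 : (Ioo (1 : ℝ) 2).Countable := (countable_coe_iff.1 h).mono hsub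
    have := Cardinal.mk_Ioo_real (show (1 : ℝ) < 2 by norm_num)
    have h3 := Cardinal.mk_le_aleph0_iff.2 (countable_coe_iff.2 h2)
    rw [this] at h3
    exact absurd h3 (not_le.2 Cardinal.aleph0_lt_continuum)
  have hR0 : (volume.restrict (Icc (0 : ℝ) 1)) Rᶜ = 0 := by
    rw [← hF.measure_preimage hR'.compl.nullMeasurableSet]
    exact measure_mono_null (fun x hx hxG => hx ⟨⟨x, hxG⟩, rfl⟩) hG0
  have : StandardBorelSpace (Gᶜ : Set X) := hG.compl.standardBorel
  have : StandardBorelSpace (Rᶜ : Set ℝ) := hR'.compl.standardBorel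
  let e1 : G ≃ᵐ R := hemb.equivRange
  let e2 : (Gᶜ : Set X) ≃ᵐ (Rᶜ : Set ℝ) := PolishSpace.measurableEquivOfNotCountable hGc hRc
  let e : X ≃ᵐ ℝ := ((MeasurableEquiv.sumCompl hG).symm.trans (MeasurableEquiv.sumCongr e1 e2)).trans
    (MeasurableEquiv.sumCompl hR')
  have he : ∀ x ∈ G, e x = F x := by
    intro x hx
    have : (MeasurableEquiv.sumCompl hG).symm x = Sum.inl ⟨x, hx⟩ :=
      Equiv.sumCompl_symm_apply_of_pos (p := (· ∈ G)) hx
    have h1 : e1 ⟨x, hx⟩ = ⟨F x, ⟨x, hx⟩, rfl⟩ := hemb.equivRange_apply _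
    have h2 : MeasurableEquiv.sumCongr e1 e2 (Sum.inl ⟨x, hx⟩) = Sum.inl (e1 ⟨x, hx⟩) := rfl
    have h3 : ∀ y : R, MeasurableEquiv.sumCompl hR' (Sum.inl y) = y := fun y => rfl
    simp only [e, MeasurableEquiv.trans_apply, this, h2, h1, h3]
  refine ⟨e, e.measurable, ?_⟩
  rw [← hF.map_eq]
  refine Measure.map_congr ?_
  filter_upwards [measure_eq_zero_iff_ae_notMem.1 hG0] with x hx
  exact he x (not_not.1 hx)

/-- Any two non-atomic standard probability spaces are isomorphic. -/
theorem exists_measurePreserving_measurableEquiv {X Y : Type*} [MeasurableSpace X]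
    [StandardBorelSpace X] [MeasurableSpace Y] [StandardBorelSpace Y]
    (μ : Measure X) [IsProbabilityMeasure μ] [NullSingletonClass μ]
    (ν : Measure Y) [IsProbabilityMeasure ν] [NullSingletonClass ν] :
    ∃ e : X ≃ᵐ Y, MeasurePreserving e μ ν := by
  obtain ⟨e, he⟩ := exists_measurableEquiv_real μ
  obtain ⟨f, hf⟩ := exists_measurableEquiv_real ν
  exact ⟨e.trans f.symm, (hf.symm f).comp he⟩

end Isomorphism

/-! ### The dual group of a countable discrete abelian group -/

section DualGroup

open Set Filter Topology

/-- The group of characters of the discrete abelian group `A`, with the topology of pointwise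
convergence. -/
def dualGroup (A : Type*) [AddCommGroup A] : Subgroup (A → Circle) where
  carrier := {y | ∀ a b, y (a + b) = y a * y b}
  one_mem' := fun _ _ => by simp
  mul_mem' := fun {x y} hx hy a b => by
    simp only [Pi.mul_apply, hx a b, hy a b, mul_mul_mul_comm]
  inv_mem' := fun {x} hx a b => by simp only [Pi.inv_apply, hx a b, mul_inv]

variable {A : Type*} [AddCommGroup A]

theorem dualGroup_map_add (y : dualGroup A) (a b : A) : y.1 (a + b) = y.1 a * y.1 b := y.2 a b

theorem isClosed_dualGroup : IsClosed (dualGroup A : Set (A → Circle)) := by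
  have : (dualGroup A : Set (A → Circle)) = ⋂ a, ⋂ b, {y | y (a + b) = y a * y b} := by
    ext y; simp [dualGroup]
  rw [this]
  exact isClosed_iInter fun a => isClosed_iInter fun b => isClosed_eq (by fun_prop) (by fun_prop)

instance : CompactSpace (dualGroup A) := isCompact_iff_compactSpace.1 isClosed_dualGroup.isCompact

noncomputable instance : MeasurableSpace (dualGroup A) := borel _

instance : BorelSpace (dualGroup A) := ⟨rfl⟩

instance [Countable A] : PolishSpace (dualGroup A) := by
  have : PolishSpace Circle := inferInstance
  exact isClosed_dualGroup.polishSpace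

theorem continuous_dualGroup_apply (a : A) : Continuous fun y : dualGroup A => y.1 a :=
  (continuous_apply a).comp continuous_subtype_val

theorem dualGroup_map_zero (y : dualGroup A) : y.1 0 = 1 := by
  simpa using dualGroup_map_add y 0 0

theorem dualGroup_map_neg (y : dualGroup A) (a : A) : y.1 (-a) = (y.1 a)⁻¹ := by
  rw [eq_inv_iff_mul_eq_one, ← dualGroup_map_add, neg_add_cancel, dualGroup_map_zero]

theorem dualGroup_map_nsmul (y : dualGroup A) (n : ℕ) (a : A) : y.1 (n • a) = y.1 a ^ n := by
  induction n with
  | zero => simp [dualGroup_map_zero]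
  | succ n ih => rw [succ_nsmul, dualGroup_map_add, ih, pow_succ]

/-- Characters separate the points of a discrete abelian group. -/
theorem exists_dualGroup_ne_one {a : A} (ha : a ≠ 0) : ∃ y : dualGroup A, y.1 a ≠ 1 := by
  obtain ⟨c, hc⟩ := CharacterModule.exists_character_apply_ne_zero_of_ne_zero ha
  -- The separating character c takes values in ℚ/ℤ. The map q ↦ exp(2πiq) embeds ℚ/ℤ in the circle.
  let f : ℚ →+ Additive Circle :=
    { toFun := fun q => Additive.ofMul (Circle.exp (2 * Real.pi * (q : ℝ)))
      map_zero' := by simp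
      map_add' := fun p q => by
        rw [← ofMul_mul, ← Circle.exp_add]; push_cast; ring_nf }
  have hf : ∀ q ∈ AddSubgroup.zmultiples (1 : ℚ), f q = 0 := by
    rintro q ⟨n, rfl⟩
    have : Circle.exp (2 * Real.pi * (n : ℝ)) = 1 := by
      rw [mul_comm]; exact Circle.exp_int_mul_two_pi n
    simpa [f] using this
  let F : AddCircle (1 : ℚ) →+ Additive Circle :=
    QuotientAddGroup.lift (AddSubgroup.zmultiples (1 : ℚ)) f hf
  have hF : ∀ z, F z = 0 → z = 0 := by
    intro z hz
    induction z using QuotientAddGroup.induction_on with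
    | H q =>
      have h1 : Circle.exp (2 * Real.pi * (q : ℝ)) = 1 := hz
      rw [Circle.exp_eq_one] at h1
      obtain ⟨n, hn⟩ := h1
      have h2 : (q : ℝ) = n := by
        have := Real.pi_pos
        have h3 : (2 * Real.pi) * ((q : ℝ) - n) = 0 := by linarith
        rcases mul_eq_zero.1 h3 with h | h <;> linarith
      have h3 : q = n := by exact_mod_cast h2
      rw [h3, QuotientAddGroup.eq_zero_iff]
      exact ⟨n, by simp⟩
  refine ⟨⟨fun b => (F (c b)).toMul, fun b b' => ?_⟩, fun h => hc (hF _ ?_)⟩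
  · simp only [map_add, toMul_add]
  · exact h

/-- If 1 were isolated, the dual would be discrete and compact, hence finite of some order n, and
every character would be trivial on n • a. This is what makes Haar measure on the dual non-atomic.
-/
theorem nhdsNE_one_dualGroup_neBot (a : A) (ha : ∀ n : ℕ, n ≠ 0 → n • a ≠ 0) :
    (𝓝[≠] (1 : dualGroup A)).NeBot := by
  refine neBot_iff.2 fun hbot => ?_
  have : DiscreteTopology (dualGroup A) :=
    discreteTopology_of_isOpen_singleton_one ((isOpen_singleton_iff_punctured_nhds _).2 hbot)
  have : Finite (dualGroup A) := finite_of_compact_of_discrete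
  obtain ⟨y, hy⟩ := exists_dualGroup_ne_one (ha (Nat.card (dualGroup A)) Nat.card_pos.ne')
  apply hy
  have h1 : y ^ Nat.card (dualGroup A) = 1 := pow_card_eq_one'
  rw [dualGroup_map_nsmul]
  exact congrFun (congrArg Subtype.val h1) a

/-- The normalised Haar measure of the dual group. -/
noncomputable def dualHaar (A : Type*) [AddCommGroup A] : Measure (dualGroup A) :=
  Measure.haarMeasure ⊤

instance : (dualHaar A).IsHaarMeasure := by unfold dualHaar; infer_instance

instance : IsProbabilityMeasure (dualHaar A) := ⟨Measure.haarMeasure_self⟩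

/-- Translating by a character z with z(a) ≠ 1 multiplies the integral by z(a) and leaves it
unchanged. -/
theorem integral_dualGroup_apply {a : A} (ha : a ≠ 0) :
    ∫ y, (y.1 a : ℂ) ∂dualHaar A = 0 := by
  obtain ⟨z, hz⟩ := exists_dualGroup_ne_one ha
  have h := integral_mul_left_eq_self (μ := dualHaar A) (fun y : dualGroup A => (y.1 a : ℂ)) z
  have h2 : ∀ y : dualGroup A, ((z * y).1 a : ℂ) = z.1 a * y.1 a := fun y => rfl
  simp only [h2, integral_const_mul] at h
  have h3 : ((z.1 a : ℂ) - 1) * ∫ y, (y.1 a : ℂ) ∂dualHaar A = 0 := by rw [sub_mul, h]; ring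
  refine (mul_eq_zero.1 h3).resolve_left fun h4 => hz ?_
  exact Circle.ext (by simpa using sub_eq_zero.1 h4)

/-- The affine map `y ↦ c · (y ∘ φ)` of the dual group. -/
noncomputable def dualAffine (φ : A ≃+ A) (c : dualGroup A) : dualGroup A ≃ₜ dualGroup A where
  toFun y := ⟨fun a => c.1 a * y.1 (φ a), fun a b => by
    simp only [map_add, dualGroup_map_add, mul_mul_mul_comm]⟩
  invFun y := ⟨fun a => (c.1 (φ.symm a))⁻¹ * y.1 (φ.symm a), fun a b => by
    simp only [map_add, dualGroup_map_add, mul_inv, mul_mul_mul_comm]⟩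
  left_inv y := by ext a; simp
  right_inv y := by ext a; simp
  continuous_toFun := Continuous.subtype_mk (continuous_pi fun a =>
    continuous_const.mul (continuous_dualGroup_apply _)) _
  continuous_invFun := Continuous.subtype_mk (continuous_pi fun a =>
    continuous_const.mul (continuous_dualGroup_apply _)) _

/-- The linear part is a continuous surjective endomorphism of a compact group, so it preserves
normalised Haar measure; the rest is a translation. -/
theorem measurePreserving_dualAffine [Countable A] (φ : A ≃+ A) (c : dualGroup A) :
    MeasurePreserving (dualAffine φ c) (dualHaar A) (dualHaar A) := by
  let f : dualGroup A →* dualGroup A := MonoidHom.mk' (dualAffine φ 1) fun x y => by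
    ext a; simp [dualAffine]
  have hf : MeasurePreserving f (dualHaar A) (dualHaar A) :=
    f.measurePreserving (dualAffine φ 1).continuous (dualAffine φ 1).surjective rfl
  have := (measurePreserving_mul_left (dualHaar A) c).comp hf
  convert this using 1
  ext y a
  simp [f, dualAffine]

/-- A square-integrable function on the dual group that is orthogonal to all characters vanishes. -/
theorem ae_eq_zero_of_integral_dualGroup_eq_zero [Countable A] {f : dualGroup A → ℂ}
    (hf : MemLp f 2 (dualHaar A))
    (h : ∀ a : A, ∫ y, (starRingEnd ℂ) (y.1 a : ℂ) * f y ∂dualHaar A = 0) :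
    f =ᵐ[dualHaar A] 0 := by
  let e : A → C(dualGroup A, ℂ) := fun a =>
    ⟨fun y => (y.1 a : ℂ), continuous_subtype_val.comp (continuous_dualGroup_apply a)⟩
  let S : StarSubalgebra ℂ C(dualGroup A, ℂ) :=
    { toSubalgebra := Algebra.adjoin ℂ (range e)
      star_mem' := by
        change Algebra.adjoin ℂ (range e) ≤ star (Algebra.adjoin ℂ (range e))
        refine Algebra.adjoin_le ?_
        rintro - ⟨a, rfl⟩
        refine Algebra.subset_adjoin ⟨-a, ContinuousMap.ext fun y => ?_⟩
        simp only [e, ContinuousMap.coe_mk, ContinuousMap.star_apply, dualGroup_map_neg,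
          Circle.coe_inv_eq_conj]
        rfl }
  -- Products of characters are characters, so the generated algebra is just their linear span, and
  -- Stone–Weierstrass gives density of the span.
  have hspan : Subalgebra.toSubmodule S.toSubalgebra = Submodule.span ℂ (range e) := by
    apply Algebra.adjoin_eq_span_of_subset
    refine Subset.trans ?_ Submodule.subset_span
    intro x hx
    refine Submonoid.closure_induction (fun _ => id) ⟨0, ?_⟩ ?_ hx
    · ext1 y; simp [e, dualGroup_map_zero]
    · rintro - - - - ⟨m, rfl⟩ ⟨n, rfl⟩
      refine ⟨m + n, ?_⟩
      ext1 y
      simp [e, dualGroup_map_add]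
  have hsep : S.SeparatesPoints := by
    intro x y hxy
    obtain ⟨a, ha⟩ : ∃ a, x.1 a ≠ y.1 a := by
      by_contra hall
      push Not at hall
      exact hxy (Subtype.ext (funext hall))
    exact ⟨_, ⟨e a, Algebra.subset_adjoin ⟨a, rfl⟩, rfl⟩, fun h => ha (Circle.ext h)⟩
  have htop := ContinuousMap.starSubalgebra_topologicalClosure_eq_top_of_separatesPoints S hsep
  have htop' : (Submodule.span ℂ (range e)).topologicalClosure = ⊤ := by
    rw [← hspan]
    exact congr_arg (Subalgebra.toSubmodule <| StarSubalgebra.toSubalgebra ·) htop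
  have hdense := (ContinuousMap.toLp_denseRange ℂ (dualHaar A) ℂ
    (p := 2) ENNReal.ofNat_ne_top).topologicalClosure_map_submodule htop'
  have hzero : hf.toLp f = 0 := by
    refine Dense.eq_zero_of_inner_right ℂ (S := Submodule.map
      (ContinuousMap.toLp 2 (dualHaar A) ℂ : C(dualGroup A, ℂ) →L[ℂ] Lp ℂ 2 (dualHaar A)).toLinearMap
        (Submodule.span ℂ (range e)))
      (Submodule.dense_iff_topologicalClosure_eq_top.2 hdense) ?_
    rintro _ ⟨g, hg, rfl⟩
    induction hg using Submodule.span_induction with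
    | zero => simp
    | add x y _ _ hx hy =>
      simp only [map_add, inner_add_left] at hx hy ⊢
      rw [hx, hy, add_zero]
    | smul c x _ hx =>
      simp only [map_smul, inner_smul_left] at hx ⊢
      rw [hx, mul_zero]
    | mem x hx =>
      obtain ⟨a, rfl⟩ := hx
      rw [L2.inner_def, ← h a]
      refine integral_congr_ae ?_
      filter_upwards [hf.coeFn_toLp, ContinuousMap.coeFn_toLp (p := 2) (𝕜 := ℂ) (dualHaar A) (e a)]
        with y h1 h2
      rw [h1]
      simp only [RCLike.inner_apply', ContinuousLinearMap.coe_coe]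
      rw [h2]
      rfl
  have h0 := hf.coeFn_toLp
  rw [hzero] at h0
  exact h0.symm.trans (Lp.coeFn_zero _ _ _)

end DualGroup

/-! ### Automorphisms of `L^∞` -/

section Automorphisms

open Set Filter Topology

variable {X : Type*} [MeasurableSpace X] {μ : Measure X}

theorem Linfty_mul_comm (f g : Lp ℂ ∞ μ) : f * g = g * f := by
  apply Lp.ext
  filter_upwards [coeFn_mul_Linfty f g, coeFn_mul_Linfty g f] with x h1 h2
  rw [h1, h2, mul_comm]

theorem Linfty_smul_mul (c : ℂ) (f g : Lp ℂ ∞ μ) : (c • f) * g = c • (f * g) := by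
  apply Lp.ext
  filter_upwards [coeFn_mul_Linfty (c • f) g, Lp.coeFn_smul c f, Lp.coeFn_smul c (f * g),
    coeFn_mul_Linfty f g] with x h1 h2 h3 h4
  rw [h1, h2, h3, Pi.smul_apply, Pi.smul_apply, h4, smul_eq_mul, smul_eq_mul, mul_assoc]

theorem Linfty_mul_smul (c : ℂ) (f g : Lp ℂ ∞ μ) : f * (c • g) = c • (f * g) := by
  rw [Linfty_mul_comm, Linfty_smul_mul, Linfty_mul_comm]

/-- The element of `L^∞` defined by a bounded measurable function. -/
noncomputable def ofBounded (f : X → ℂ) (hf : Measurable f) (C : ℝ) (h : ∀ x, ‖f x‖ ≤ C) :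
    Lp ℂ ∞ μ :=
  (memLp_top_of_bound hf.aestronglyMeasurable C (Eventually.of_forall h)).toLp f

theorem coeFn_ofBounded (f : X → ℂ) (hf : Measurable f) (C : ℝ) (h : ∀ x, ‖f x‖ ≤ C) :
    ⇑(ofBounded f hf C h : Lp ℂ ∞ μ) =ᵐ[μ] f :=
  MemLp.coeFn_toLp _

/-- The unit of `L^∞`. -/
noncomputable def oneLinfty : Lp ℂ ∞ μ := ofBounded (fun _ => 1) measurable_const 1 (by simp)

theorem coeFn_oneLinfty : ⇑(oneLinfty : Lp ℂ ∞ μ) =ᵐ[μ] fun _ => 1 := coeFn_ofBounded _ _ _ _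

theorem oneLinfty_mul (f : Lp ℂ ∞ μ) : oneLinfty * f = f := by
  apply Lp.ext
  filter_upwards [coeFn_mul_Linfty oneLinfty f, coeFn_oneLinfty (μ := μ)] with x h1 h2
  rw [h1, h2, one_mul]

/-- The indicator function of a measurable set. -/
noncomputable def indLinfty {E : Set X} (hE : MeasurableSet E) : Lp ℂ ∞ μ :=
  ofBounded (E.indicator fun _ => 1) (measurable_const.indicator hE) 1 fun x => by
    by_cases h : x ∈ E <;> simp [h]

theorem coeFn_indLinfty {E : Set X} (hE : MeasurableSet E) :
    ⇑(indLinfty hE : Lp ℂ ∞ μ) =ᵐ[μ] E.indicator fun _ => 1 := coeFn_ofBounded _ _ _ _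

/-- The automorphisms are not unital by definition; the unit is preserved because it is the neutral
element for multiplication and α is surjective. -/
theorem map_oneLinfty (α : AutLinfty μ) : α oneLinfty = oneLinfty := by
  have h : α (oneLinfty * α.symm oneLinfty) = oneLinfty := by
    rw [oneLinfty_mul, StarAlgEquiv.apply_symm_apply]
  rwa [map_mul, StarAlgEquiv.apply_symm_apply, Linfty_mul_comm, oneLinfty_mul] at h

/-- Automorphisms of `L^∞` are contractive. -/
theorem norm_map_le_of_norm_le (α : AutLinfty μ) (f : Lp ℂ ∞ μ) {r : ℝ} (hr : 0 ≤ r)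
    (hf : ∀ᵐ x ∂μ, ‖f x‖ ≤ r) : ∀ᵐ x ∂μ, ‖α f x‖ ≤ r := by
  have hmf : Measurable ⇑f := (Lp.stronglyMeasurable f).measurable
  -- G is chosen so that |f|² + |G|² = r². This is an algebraic identity, so it survives α and
  -- bounds |α f|.
  let G : X → ℂ := fun x => ((Real.sqrt (r ^ 2 - ‖f x‖ ^ 2) : ℝ) : ℂ)
  have hG : Measurable G := by fun_prop
  let g : Lp ℂ ∞ μ := ofBounded G hG r fun x => by
    rw [Complex.norm_real, Real.norm_eq_abs, abs_of_nonneg (Real.sqrt_nonneg _)]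
    calc Real.sqrt (r ^ 2 - ‖f x‖ ^ 2) ≤ Real.sqrt (r ^ 2) :=
          Real.sqrt_le_sqrt (by nlinarith [sq_nonneg ‖f x‖])
      _ = r := Real.sqrt_sq hr
  have key : f * star f + g * star g = ((r ^ 2 : ℝ) : ℂ) • oneLinfty := by
    apply Lp.ext
    filter_upwards [Lp.coeFn_add (f * star f) (g * star g), coeFn_mul_Linfty f (star f),
      coeFn_mul_Linfty g (star g), Lp.coeFn_star f, Lp.coeFn_star g, coeFn_ofBounded G hG r _,
      Lp.coeFn_smul ((r ^ 2 : ℝ) : ℂ) (oneLinfty : Lp ℂ ∞ μ), coeFn_oneLinfty (μ := μ), hf]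
      with x h1 h2 h3 h4 h5 h6 h7 h8 h9
    rw [h1, Pi.add_apply, h2, h3, h4, h5, Pi.star_apply, Pi.star_apply, h6, h7, Pi.smul_apply, h8,
      smul_eq_mul, mul_one]
    simp only [G, Complex.star_def, Complex.mul_conj, Complex.normSq_eq_norm_sq, Complex.norm_real,
      Real.norm_eq_abs, sq_abs]
    rw [Real.sq_sqrt (by nlinarith [norm_nonneg (f x)])]
    push_cast
    ring
  have key2 := congrArg α key
  rw [map_add, map_mul, map_mul, map_star, map_star, map_smul, map_oneLinfty] at key2
  filter_upwards [Lp.coeFn_add (α f * star (α f)) (α g * star (α g)),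
    coeFn_mul_Linfty (α f) (star (α f)), coeFn_mul_Linfty (α g) (star (α g)), Lp.coeFn_star (α f),
    Lp.coeFn_star (α g), Lp.coeFn_smul ((r ^ 2 : ℝ) : ℂ) (oneLinfty : Lp ℂ ∞ μ),
    coeFn_oneLinfty (μ := μ)] with x h1 h2 h3 h4 h5 h7 h8
  rw [key2, h7, Pi.smul_apply, h8, Pi.add_apply, h2, h3, h4, h5, Pi.star_apply, Pi.star_apply,
    smul_eq_mul, mul_one] at h1
  simp only [Complex.star_def, Complex.mul_conj, Complex.normSq_eq_norm_sq] at h1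
  have h9 : r ^ 2 = ‖α f x‖ ^ 2 + ‖α g x‖ ^ 2 := by exact_mod_cast h1
  nlinarith [sq_nonneg ‖α g x‖, norm_nonneg (α f x)]

theorem indLinfty_mul_self {E : Set X} (hE : MeasurableSet E) :
    (indLinfty hE : Lp ℂ ∞ μ) * indLinfty hE = indLinfty hE := by
  apply Lp.ext
  filter_upwards [coeFn_mul_Linfty (indLinfty hE : Lp ℂ ∞ μ) (indLinfty hE), coeFn_indLinfty hE]
    with x h1 h2
  rw [h1, h2]
  by_cases h : x ∈ E <;> simp [h]

theorem map_indLinfty_eq_zero_or_one (α : AutLinfty μ) {E : Set X} (hE : MeasurableSet E) :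
    ∀ᵐ x ∂μ, α (indLinfty hE) x = 0 ∨ α (indLinfty hE) x = 1 := by
  have h := congrArg α (indLinfty_mul_self (μ := μ) hE)
  rw [map_mul] at h
  filter_upwards [coeFn_mul_Linfty (α (indLinfty hE)) (α (indLinfty hE))] with x h1
  rw [h] at h1
  rcases eq_or_ne (α (indLinfty hE) x) 0 with h2 | h2
  · exact Or.inl h2
  · exact Or.inr (mul_left_cancel₀ h2 (by rw [← h1, mul_one]))

/-- If `γ(1_E) 1_E = γ(1_E)` and similarly for `γ⁻¹`, then `γ` fixes `1_E`. -/
theorem map_indLinfty_of_mul (γ : AutLinfty μ) {E : Set X} (hE : MeasurableSet E)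
    (h : γ (indLinfty hE) * indLinfty hE = γ (indLinfty hE))
    (h' : γ.symm (indLinfty hE) * indLinfty hE = γ.symm (indLinfty hE)) :
    γ (indLinfty hE) = indLinfty hE := by
  have h2 := congrArg γ h'
  rw [map_mul, StarAlgEquiv.apply_symm_apply] at h2
  rw [← h, Linfty_mul_comm, h2]

/-- The function 1_E (v − z) is bounded by r, hence so is its image γ(1_E)(v − z). So γ(1_E) lives
where |V − z| ≤ r, which is E. -/
theorem map_indLinfty_ball_mul (γ : AutLinfty μ) (v : Lp ℂ ∞ μ) (hv : γ v = v) {V : X → ℂ}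
    (hvV : ⇑v =ᵐ[μ] V) (z : ℂ) {r : ℝ} (hr : 0 ≤ r)
    (hE : MeasurableSet (V ⁻¹' Metric.closedBall z r)) :
    γ (indLinfty hE) * indLinfty hE = γ (indLinfty hE) := by
  have h1 : ∀ᵐ x ∂μ, ‖(indLinfty hE * (v + (-z) • oneLinfty) : Lp ℂ ∞ μ) x‖ ≤ r := by
    filter_upwards [coeFn_mul_Linfty (indLinfty hE) (v + (-z) • oneLinfty), coeFn_indLinfty hE, hvV,
      Lp.coeFn_add v ((-z) • oneLinfty), Lp.coeFn_smul (-z) (oneLinfty : Lp ℂ ∞ μ),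
      coeFn_oneLinfty (μ := μ)] with x h1 h2 h3 h4 h5 h6
    rw [h1, h2, h4, Pi.add_apply, h5, Pi.smul_apply, h6, h3, smul_eq_mul, mul_one]
    by_cases h : x ∈ V ⁻¹' Metric.closedBall z r
    · rw [indicator_of_mem h, one_mul, ← sub_eq_add_neg]
      exact mem_closedBall_iff_norm.1 h
    · rw [indicator_of_notMem h, zero_mul, norm_zero]
      exact hr
  have h2 := norm_map_le_of_norm_le γ _ hr h1
  rw [map_mul, map_add, map_smul, map_oneLinfty, hv] at h2
  apply Lp.ext
  filter_upwards [h2, coeFn_mul_Linfty (γ (indLinfty hE)) (v + (-z) • oneLinfty),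
    coeFn_mul_Linfty (γ (indLinfty hE)) (indLinfty hE), map_indLinfty_eq_zero_or_one γ hE,
    coeFn_indLinfty hE, hvV, Lp.coeFn_add v ((-z) • oneLinfty),
    Lp.coeFn_smul (-z) (oneLinfty : Lp ℂ ∞ μ), coeFn_oneLinfty (μ := μ)]
    with x h2 h3 h4 h5 h6 h7 h8 h9 h10
  rw [h4]
  rcases h5 with h5 | h5
  · rw [h5, zero_mul]
  · rw [h3, h8, Pi.add_apply, h9, Pi.smul_apply, h10, h7, h5, smul_eq_mul, mul_one, one_mul,
      ← sub_eq_add_neg] at h2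
    rw [h5, one_mul, h6,
      indicator_of_mem (show x ∈ V ⁻¹' Metric.closedBall z r from mem_closedBall_iff_norm.2 h2)]

theorem map_indLinfty_ball (γ : AutLinfty μ) (v : Lp ℂ ∞ μ) (hv : γ v = v) {V : X → ℂ}
    (hvV : ⇑v =ᵐ[μ] V) (z : ℂ) {r : ℝ} (hr : 0 ≤ r)
    (hE : MeasurableSet (V ⁻¹' Metric.closedBall z r)) :
    γ (indLinfty hE) = indLinfty hE := by
  refine map_indLinfty_of_mul γ hE (map_indLinfty_ball_mul γ v hv hvV z hr hE)
    (map_indLinfty_ball_mul γ.symm v ?_ hvV z hr hE)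
  conv_lhs => rw [← hv]
  exact StarAlgEquiv.symm_apply_apply _ _

/-- The σ-algebra of all sets whose indicator function is fixed by an automorphism. -/
@[reducible]
noncomputable def fixedSigmaAlgebra (γ : AutLinfty μ) : MeasurableSpace X where
  MeasurableSet' E := ∃ hE : MeasurableSet E, γ (indLinfty hE) = indLinfty hE
  measurableSet_empty := ⟨MeasurableSet.empty, by
    have : (indLinfty MeasurableSet.empty : Lp ℂ ∞ μ) = 0 := by
      apply Lp.ext
      filter_upwards [coeFn_indLinfty (μ := μ) MeasurableSet.empty, Lp.coeFn_zero ℂ ∞ μ] with x h1 h2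
      rw [h1, h2]; simp
    rw [this, map_zero]⟩
  measurableSet_compl E := by
    rintro ⟨hE, h⟩
    refine ⟨hE.compl, ?_⟩
    have : (indLinfty hE.compl : Lp ℂ ∞ μ) = oneLinfty + (-1 : ℂ) • indLinfty hE := by
      apply Lp.ext
      filter_upwards [coeFn_indLinfty (μ := μ) hE.compl, coeFn_indLinfty (μ := μ) hE,
        Lp.coeFn_add (oneLinfty : Lp ℂ ∞ μ) ((-1 : ℂ) • indLinfty hE),
        Lp.coeFn_smul (-1 : ℂ) (indLinfty hE : Lp ℂ ∞ μ), coeFn_oneLinfty (μ := μ)]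
        with x h1 h2 h3 h4 h5
      rw [h1, h3, Pi.add_apply, h4, Pi.smul_apply, h5, h2]
      by_cases h : x ∈ E <;> simp [h]
    rw [this, map_add, map_smul, map_oneLinfty, h]
  measurableSet_iUnion E hE := by
    choose hm h using hE
    have hU : MeasurableSet (⋃ i, E i) := MeasurableSet.iUnion hm
    -- This says 1_U ≤ δ(1_U). Applying it to γ and to its inverse gives equality.
    have aux : ∀ δ : AutLinfty μ, (∀ i, δ (indLinfty (hm i)) = indLinfty (hm i)) →
        indLinfty hU * δ (indLinfty hU) = indLinfty hU := by
      intro δ hδ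
      have hi : ∀ i, (indLinfty (hm i) : Lp ℂ ∞ μ) * δ (indLinfty hU) = indLinfty (hm i) := by
        intro i
        have : (indLinfty (hm i) : Lp ℂ ∞ μ) * indLinfty hU = indLinfty (hm i) := by
          apply Lp.ext
          filter_upwards [coeFn_mul_Linfty (indLinfty (hm i) : Lp ℂ ∞ μ) (indLinfty hU),
            coeFn_indLinfty (μ := μ) (hm i), coeFn_indLinfty (μ := μ) hU] with x h1 h2 h3
          rw [h1, h2, h3]
          by_cases h : x ∈ E i
          · rw [indicator_of_mem h, indicator_of_mem (mem_iUnion_of_mem i h), mul_one]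
          · rw [indicator_of_notMem h, zero_mul]
        have h2 := congrArg δ this
        rwa [map_mul, hδ] at h2
      apply Lp.ext
      filter_upwards [ae_all_iff.2 fun i => coeFn_mul_Linfty (indLinfty (hm i)) (δ (indLinfty hU)),
        ae_all_iff.2 fun i => coeFn_indLinfty (μ := μ) (hm i), coeFn_indLinfty (μ := μ) hU,
        coeFn_mul_Linfty (indLinfty hU) (δ (indLinfty hU))] with x h1 h2 h3 h4
      rw [h4, h3]
      by_cases h : x ∈ ⋃ i, E i
      · obtain ⟨i, hxi⟩ := mem_iUnion.1 h
        have := h1 i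
        rw [hi, h2, indicator_of_mem hxi, one_mul] at this
        rw [indicator_of_mem h, one_mul, ← this]
      · rw [indicator_of_notMem h, zero_mul]
    refine ⟨hU, ?_⟩
    have h1 := aux γ h
    have h2 := aux γ.symm fun i => by
      conv_lhs => rw [← h i]
      exact StarAlgEquiv.symm_apply_apply _ _
    have h3 := congrArg γ h2
    rw [map_mul, StarAlgEquiv.apply_symm_apply] at h3
    rw [← h3, Linfty_mul_comm, h1]

/-- Closed balls around a dense sequence suffice, since every open subset of ℂ is a countable union
of them. This turns "γ fixes the function v" into "γ fixes all sets that v determines". -/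
theorem measurable_fixedSigmaAlgebra (γ : AutLinfty μ) (v : Lp ℂ ∞ μ) (hv : γ v = v) {V : X → ℂ}
    (hV : Measurable V) (hvV : ⇑v =ᵐ[μ] V) : @Measurable _ _ (fixedSigmaAlgebra γ) _ V := by
  refine @measurable_of_isOpen _ _ _ _ _ (fixedSigmaAlgebra γ) _ fun U hU => ?_
  have hcov : U = ⋃ p : {p : ℕ × ℕ //
      Metric.closedBall (TopologicalSpace.denseSeq ℂ p.1) (1 / ((p.2 : ℝ) + 1)) ⊆ U},
      Metric.closedBall (TopologicalSpace.denseSeq ℂ p.1.1) (1 / ((p.1.2 : ℝ) + 1)) := by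
    refine subset_antisymm (fun z hz => ?_) (iUnion_subset fun p => p.2)
    obtain ⟨ε, hε, hball⟩ := Metric.isOpen_iff.1 hU z hz
    obtain ⟨n, hn⟩ := exists_nat_one_div_lt (half_pos hε)
    obtain ⟨k, hk⟩ := (TopologicalSpace.denseRange_denseSeq ℂ).exists_dist_lt z
      (Nat.one_div_pos_of_nat (α := ℝ) (n := n))
    refine mem_iUnion.2 ⟨⟨(k, n), fun w hw => hball ?_⟩, ?_⟩
    · have h1 : dist w (TopologicalSpace.denseSeq ℂ k) ≤ 1 / ((n : ℝ) + 1) := hw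
      have h2 := dist_triangle w (TopologicalSpace.denseSeq ℂ k) z
      rw [dist_comm] at hk
      rw [Metric.mem_ball]
      linarith
    · exact hk.le
  rw [hcov, preimage_iUnion]
  refine @MeasurableSet.iUnion _ _ (fixedSigmaAlgebra γ) _ _ fun p => ?_
  exact ⟨hV Metric.isClosed_closedBall.measurableSet,
    map_indLinfty_ball γ v hv hvV _ (by positivity) _⟩

/-- An automorphism that fixes all indicator functions is trivial. -/
theorem eq_of_forall_map_indLinfty (γ : AutLinfty μ)
    (h : ∀ (E : Set X) (hE : MeasurableSet E), γ (indLinfty hE) = indLinfty hE) (f : Lp ℂ ∞ μ) :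
    γ f = f := by
  have hmf : Measurable ⇑f := (Lp.stronglyMeasurable f).measurable
  have key : ∀ (r : ℝ) (hr : 0 < r), ∀ᵐ x ∂μ, ‖γ f x - f x‖ ≤ 2 * r := by
    intro r hr
    -- On E, the preimage of a ball of centre z, contractivity applied to 1_E (f − z) puts both f
    -- and γ f within r of z.
    have hk : ∀ k : ℕ, ∀ᵐ x ∂μ, f x ∈ Metric.closedBall (TopologicalSpace.denseSeq ℂ k) r →
        ‖γ f x - f x‖ ≤ 2 * r := by
      intro k
      set z := TopologicalSpace.denseSeq ℂ k
      have hE : MeasurableSet (⇑f ⁻¹' Metric.closedBall z r) :=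
        hmf Metric.isClosed_closedBall.measurableSet
      have h1 : ∀ᵐ x ∂μ, ‖(indLinfty hE * (f + (-z) • oneLinfty) : Lp ℂ ∞ μ) x‖ ≤ r := by
        filter_upwards [coeFn_mul_Linfty (indLinfty hE) (f + (-z) • oneLinfty), coeFn_indLinfty hE,
          Lp.coeFn_add f ((-z) • oneLinfty), Lp.coeFn_smul (-z) (oneLinfty : Lp ℂ ∞ μ),
          coeFn_oneLinfty (μ := μ)] with x h1 h2 h4 h5 h6
        rw [h1, h2, h4, Pi.add_apply, h5, Pi.smul_apply, h6, smul_eq_mul, mul_one]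
        by_cases h : x ∈ ⇑f ⁻¹' Metric.closedBall z r
        · rw [indicator_of_mem h, one_mul, ← sub_eq_add_neg]
          exact mem_closedBall_iff_norm.1 h
        · rw [indicator_of_notMem h, zero_mul, norm_zero]
          exact hr.le
      have h2 := norm_map_le_of_norm_le γ _ hr.le h1
      rw [map_mul, map_add, map_smul, map_oneLinfty, h] at h2
      filter_upwards [h2, coeFn_mul_Linfty (indLinfty hE) (γ f + (-z) • oneLinfty),
        coeFn_indLinfty hE, Lp.coeFn_add (γ f) ((-z) • oneLinfty),
        Lp.coeFn_smul (-z) (oneLinfty : Lp ℂ ∞ μ), coeFn_oneLinfty (μ := μ)]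
        with x h2 h3 h6 h8 h9 h10 hx
      rw [h3, h8, Pi.add_apply, h9, Pi.smul_apply, h10, h6,
        indicator_of_mem (show x ∈ ⇑f ⁻¹' Metric.closedBall z r from hx), smul_eq_mul, mul_one,
        one_mul, ← sub_eq_add_neg] at h2
      have h11 : ‖f x - z‖ ≤ r := mem_closedBall_iff_norm.1 hx
      calc ‖γ f x - f x‖ = ‖(γ f x - z) - (f x - z)‖ := by ring_nf
        _ ≤ ‖γ f x - z‖ + ‖f x - z‖ := norm_sub_le _ _
        _ ≤ 2 * r := by linarith
    filter_upwards [ae_all_iff.2 hk] with x hx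
    obtain ⟨k, hk⟩ := (TopologicalSpace.denseRange_denseSeq ℂ).exists_dist_lt (f x) hr
    exact hx k hk.le
  apply Lp.ext
  filter_upwards [ae_all_iff.2 fun n : ℕ => key (1 / ((n : ℝ) + 1)) Nat.one_div_pos_of_nat] with x hx
  refine sub_eq_zero.1 (norm_le_zero_iff.1 (le_of_forall_pos_le_add fun ε hε => ?_))
  obtain ⟨n, hn⟩ := exists_nat_one_div_lt (half_pos hε)
  have := hx n
  linarith

/-- The automorphism of `L^∞` given by composition with a measure-preserving isomorphism. -/
noncomputable def compAut (R : X ≃ᵐ X) (hR : MeasurePreserving R μ μ) : AutLinfty μ where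
  toFun f := Lp.compMeasurePreserving R hR f
  invFun f := Lp.compMeasurePreserving R.symm (hR.symm R) f
  left_inv f := by
    apply Lp.ext
    filter_upwards [Lp.coeFn_compMeasurePreserving (Lp.compMeasurePreserving R hR f) (hR.symm R),
      (hR.symm R).quasiMeasurePreserving.ae_eq_comp (Lp.coeFn_compMeasurePreserving f hR)]
      with x h1 h2
    rw [h1, h2]; simp
  right_inv f := by
    apply Lp.ext
    filter_upwards [Lp.coeFn_compMeasurePreserving (Lp.compMeasurePreserving R.symm (hR.symm R) f) hR,
      hR.quasiMeasurePreserving.ae_eq_comp (Lp.coeFn_compMeasurePreserving f (hR.symm R))]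
      with x h1 h2
    rw [h1, h2]; simp
  map_mul' f g := by
    apply Lp.ext
    filter_upwards [Lp.coeFn_compMeasurePreserving (f * g) hR, Lp.coeFn_compMeasurePreserving f hR,
      Lp.coeFn_compMeasurePreserving g hR, hR.quasiMeasurePreserving.ae_eq_comp (coeFn_mul_Linfty f g),
      coeFn_mul_Linfty (Lp.compMeasurePreserving R hR f) (Lp.compMeasurePreserving R hR g)]
      with x h1 h2 h3 h4 h5
    rw [h1, h5, h2, h3, h4]; simp
  map_add' f g := map_add _ f g
  map_star' f := by
    apply Lp.ext
    filter_upwards [Lp.coeFn_compMeasurePreserving (star f) hR, Lp.coeFn_compMeasurePreserving f hR,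
      hR.quasiMeasurePreserving.ae_eq_comp (Lp.coeFn_star f),
      Lp.coeFn_star (Lp.compMeasurePreserving R hR f)] with x h1 h2 h3 h4
    rw [h1, h4, Pi.star_apply, h2, h3]; simp
  map_smul' c f := by
    apply Lp.ext
    filter_upwards [Lp.coeFn_compMeasurePreserving (c • f) hR, Lp.coeFn_compMeasurePreserving f hR,
      hR.quasiMeasurePreserving.ae_eq_comp (Lp.coeFn_smul c f),
      Lp.coeFn_smul c (Lp.compMeasurePreserving R hR f)] with x h1 h2 h3 h4
    rw [h1, h4, Pi.smul_apply, h2, h3]; simp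

theorem coeFn_compAut (R : X ≃ᵐ X) (hR : MeasurePreserving R μ μ) (f : Lp ℂ ∞ μ) :
    ⇑(compAut R hR f) =ᵐ[μ] fun x => f (R x) :=
  Lp.coeFn_compMeasurePreserving f hR

end Automorphisms

/-! ### Fourier analysis on a probability space modelled on a dual group -/

section Fourier

open Set Filter Topology

/-- An identification of a measure space with the dual of the discrete abelian group `A`, given by
the characters `u a`. -/
structure FourierModel (A : Type*) [AddCommGroup A] {X : Type*} [MeasurableSpace X]
    (μ : Measure X) where
  /-- The characters. -/
  u : A → X → Circle
  measurable_u : ∀ a, Measurable fun x => (u a x : ℂ)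
  u_add : ∀ a b x, u (a + b) x = u a x * u b x
  integral_u : ∀ a, a ≠ 0 → ∫ x, (u a x : ℂ) ∂μ = 0
  injective : ∀ x y, (∀ a, u a x = u a y) → x = y
  complete : ∀ f : X → ℂ, MemLp f 2 μ →
    (∀ a, ∫ x, (starRingEnd ℂ) (u a x : ℂ) * f x ∂μ = 0) → f =ᵐ[μ] 0
  exists_affine : ∀ (φ : A ≃+ A) (c : A → Circle), (∀ a b, c (a + b) = c a * c b) →
    ∃ R : X ≃ᵐ X, MeasurePreserving R μ μ ∧ ∀ a x, u a (R x) = c a * u (φ a) x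

/-- A non-atomic standard probability space is modelled on the dual of every countable abelian
group with an element of infinite order. -/
theorem nonempty_fourierModel {X : Type*} [MeasurableSpace X] [StandardBorelSpace X]
    (μ : Measure X) [IsProbabilityMeasure μ] [NullSingletonClass μ]
    {A : Type*} [AddCommGroup A] [Countable A] (a : A) (ha : ∀ n : ℕ, n ≠ 0 → n • a ≠ 0) :
    Nonempty (FourierModel A μ) := by
  have := nhdsNE_one_dualGroup_neBot a ha
  obtain ⟨e, he⟩ := exists_measurePreserving_measurableEquiv μ (dualHaar A)
  have hmeas : ∀ a : A, Measurable fun y : dualGroup A => (y.1 a : ℂ) := fun a =>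
    (continuous_subtype_val.comp (continuous_dualGroup_apply a)).measurable
  refine ⟨⟨fun a x => (e x).1 a, fun a => (hmeas a).comp e.measurable,
    fun a b x => dualGroup_map_add _ _ _, fun a ha => ?_, fun x y h => ?_, fun f hf h => ?_,
    fun φ c hc => ?_⟩⟩
  · rw [he.integral_comp' (f := e) (fun y : dualGroup A => (y.1 a : ℂ))]
    exact integral_dualGroup_apply ha
  · exact e.injective (Subtype.ext (funext h))
  · have hs := he.symm e
    have h1 := ae_eq_zero_of_integral_dualGroup_eq_zero (f := f ∘ e.symm)
      (hf.comp_measurePreserving hs) fun a => by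
        rw [← h a, ← he.integral_comp' (f := e)]
        simp
    filter_upwards [he.quasiMeasurePreserving.ae h1] with x hx
    simpa using hx
  · let c' : dualGroup A := ⟨c, hc⟩
    refine ⟨(e.trans (dualAffine φ c').toMeasurableEquiv).trans e.symm,
      (he.symm e).comp ((measurePreserving_dualAffine φ c').comp he), fun a x => ?_⟩
    simp [dualAffine, c']

namespace FourierModel

variable {A : Type*} [AddCommGroup A] {X : Type*} [MeasurableSpace X] {μ : Measure X}
  (M : FourierModel A μ)

theorem u_zero (x : X) : M.u 0 x = 1 := by simpa using M.u_add 0 0 x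

theorem u_neg (a : A) (x : X) : M.u (-a) x = (M.u a x)⁻¹ := by
  rw [eq_inv_iff_mul_eq_one, ← M.u_add, neg_add_cancel, M.u_zero]

/-- The characters as elements of `L^∞`. -/
noncomputable def char (a : A) : Lp ℂ ∞ μ :=
  ofBounded (fun x => (M.u a x : ℂ)) (M.measurable_u a) 1 fun _ => (Circle.norm_coe _).le

theorem coeFn_char (a : A) : ⇑(M.char a) =ᵐ[μ] fun x => (M.u a x : ℂ) := coeFn_ofBounded _ _ _ _

theorem char_add (a b : A) : M.char (a + b) = M.char a * M.char b := by
  apply Lp.ext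
  filter_upwards [M.coeFn_char (a + b), M.coeFn_char a, M.coeFn_char b,
    coeFn_mul_Linfty (M.char a) (M.char b)] with x h1 h2 h3 h4
  rw [h1, h4, h2, h3, M.u_add, Circle.coe_mul]

theorem char_zero : M.char 0 = oneLinfty := by
  apply Lp.ext
  filter_upwards [M.coeFn_char 0, coeFn_oneLinfty (μ := μ)] with x h1 h2
  rw [h1, h2, M.u_zero, Circle.coe_one]

/-- An automorphism of `L^∞` is determined by its values on characters. -/
theorem aut_ext [Countable A] [StandardBorelSpace X] {α α' : AutLinfty μ}
    (h : ∀ a, α (M.char a) = α' (M.char a)) : α = α' := by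
  set γ : AutLinfty μ := α'⁻¹ * α
  have hγ : ∀ a, γ (M.char a) = M.char a := fun a => by
    change α'.symm (α (M.char a)) = _
    rw [h, StarAlgEquiv.symm_apply_apply]
  suffices hs : γ = 1 from (inv_mul_eq_one.1 hs).symm
  refine StarAlgEquiv.ext fun f => eq_of_forall_map_indLinfty γ (fun E hE => ?_) f
  have hmeas : Measurable fun x a => (M.u a x : ℂ) := measurable_pi_iff.2 M.measurable_u
  -- An injective Borel map between standard Borel spaces is an embedding (Lusin–Souslin), so the
  -- countably many characters generate the Borel σ-algebra.
  have hemb : MeasurableEmbedding fun x a => (M.u a x : ℂ) :=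
    hmeas.measurableEmbedding fun x y hxy =>
      M.injective x y fun a => Circle.ext (congrFun hxy a)
  have hmeas' : @Measurable _ _ (fixedSigmaAlgebra γ) _ fun x a => (M.u a x : ℂ) :=
    (@measurable_pi_iff _ _ _ (fixedSigmaAlgebra γ) _ _).2 fun a =>
      measurable_fixedSigmaAlgebra γ (M.char a) (hγ a) (M.measurable_u a) (M.coeFn_char a)
  have hE' : MeasurableSet[fixedSigmaAlgebra γ] E := by
    obtain ⟨F, hF, rfl⟩ : ∃ F, MeasurableSet F ∧ (fun x a => (M.u a x : ℂ)) ⁻¹' F = E :=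
      ⟨_, hemb.measurableSet_image.2 hE, preimage_image_eq _ hemb.injective⟩
    exact hmeas' hF
  exact hE'.2

/-! ### Fourier coefficients and the orthonormal basis of characters -/

variable [IsProbabilityMeasure μ]

theorem coeFn_toL2 (f : Lp ℂ ∞ μ) : ⇑(toL2 f) =ᵐ[μ] f := MemLp.coeFn_toLp _

theorem toL2_injective : Function.Injective (toL2 : Lp ℂ ∞ μ → Lp ℂ 2 μ) := fun f g h => by
  apply Lp.ext
  have h1 := coeFn_toL2 f
  rw [h] at h1
  exact h1.symm.trans (coeFn_toL2 g)

theorem inner_toL2 (f g : Lp ℂ ∞ μ) :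
    inner ℂ (toL2 f) (toL2 g) = ∫ x, (starRingEnd ℂ) (f x) * g x ∂μ := by
  rw [L2.inner_def]
  refine integral_congr_ae ?_
  filter_upwards [coeFn_toL2 f, coeFn_toL2 g] with x h1 h2
  rw [h1, h2, RCLike.inner_apply']

theorem orthonormal_char : Orthonormal ℂ fun a => toL2 (M.char a) := by
  classical
  rw [orthonormal_iff_ite]
  intro a b
  have h : inner ℂ (toL2 (M.char a)) (toL2 (M.char b)) = ∫ x, (M.u (b - a) x : ℂ) ∂μ := by
    rw [inner_toL2]
    refine integral_congr_ae ?_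
    filter_upwards [M.coeFn_char a, M.coeFn_char b] with x h1 h2
    rw [h1, h2, sub_eq_add_neg, M.u_add, M.u_neg, ← Circle.coe_inv_eq_conj, ← Circle.coe_mul, mul_comm]
  rw [h]
  split_ifs with hab
  · simp [hab, M.u_zero]
  · exact M.integral_u _ (sub_ne_zero.2 (Ne.symm hab))

theorem span_char_orthogonal : (Submodule.span ℂ (range fun a => toL2 (M.char a)))ᗮ = ⊥ := by
  rw [Submodule.eq_bot_iff]
  intro f hf
  rw [Submodule.mem_orthogonal] at hf
  have h := M.complete f (Lp.memLp f) fun a => by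
    rw [← hf _ (Submodule.subset_span ⟨a, rfl⟩), L2.inner_def]
    refine integral_congr_ae ?_
    filter_upwards [M.coeFn_char a, coeFn_toL2 (M.char a)] with x h1 h2
    rw [h2, h1, RCLike.inner_apply']
  exact Lp.ext (h.trans (Lp.coeFn_zero _ _ _).symm)

/-- The characters form a Hilbert basis of `L²`. -/
noncomputable def basis : HilbertBasis A ℂ (Lp ℂ 2 μ) :=
  HilbertBasis.mkOfOrthogonalEqBot M.orthonormal_char M.span_char_orthogonal

theorem basis_apply (a : A) : M.basis a = toL2 (M.char a) := by
  simp [basis]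

/-- The Fourier coefficients of a bounded function. -/
noncomputable def coef (f : Lp ℂ ∞ μ) (a : A) : ℂ := inner ℂ (toL2 (M.char a)) (toL2 f)

theorem coef_eq_integral (f : Lp ℂ ∞ μ) (a : A) :
    M.coef f a = ∫ x, (starRingEnd ℂ) (M.u a x : ℂ) * f x ∂μ := by
  rw [coef, inner_toL2]
  refine integral_congr_ae ?_
  filter_upwards [M.coeFn_char a] with x h1
  rw [h1]

theorem toL2_smul (c : ℂ) (f : Lp ℂ ∞ μ) : toL2 (c • f) = c • toL2 f := by
  apply Lp.ext
  filter_upwards [coeFn_toL2 (c • f), Lp.coeFn_smul c f, Lp.coeFn_smul c (toL2 f), coeFn_toL2 f]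
    with x h1 h2 h3 h4
  rw [h1, h2, h3, Pi.smul_apply, Pi.smul_apply, h4]

theorem coef_char [DecidableEq A] (a b : A) : M.coef (M.char b) a = if a = b then 1 else 0 :=
  orthonormal_iff_ite.1 M.orthonormal_char a b

theorem coef_smul (c : ℂ) (f : Lp ℂ ∞ μ) (a : A) : M.coef (c • f) a = c * M.coef f a := by
  rw [coef, toL2_smul, inner_smul_right, coef]

theorem ext_coef {f g : Lp ℂ ∞ μ} (h : ∀ a, M.coef f a = M.coef g a) : f = g := by
  apply toL2_injective
  have h2 : M.basis.repr (toL2 f) = M.basis.repr (toL2 g) := by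
    ext a
    rw [M.basis.repr_apply_apply, M.basis.repr_apply_apply, M.basis_apply]
    exact h a
  exact M.basis.repr.injective h2

theorem char_injective : Function.Injective M.char := by
  classical
  intro a b h
  by_contra hab
  have h1 := M.coef_char a a
  rw [h, M.coef_char a b, if_neg hab, if_pos rfl] at h1
  exact zero_ne_one h1

/-- Fourier coefficients that are constant in absolute value on an infinite set vanish. -/
theorem coef_eq_zero_of_infinite (f : Lp ℂ ∞ μ) {s : Set A} (hs : s.Infinite) (r : ℝ)
    (h : ∀ a ∈ s, ‖M.coef f a‖ = r) : r = 0 := by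
  by_contra hr
  have h1 := M.orthonormal_char.inner_products_summable (toL2 f)
  have h2 := h1.subtype s
  have h3 : (fun a => ‖inner ℂ (toL2 (M.char a)) (toL2 f)‖ ^ 2) ∘ (Subtype.val : s → A)
      = fun _ => r ^ 2 := by
    ext a
    have := h a a.2
    rw [coef] at this
    simp [this]
  have : Infinite s := hs.to_subtype
  change Summable ((fun a => ‖inner ℂ (toL2 (M.char a)) (toL2 f)‖ ^ 2) ∘ (Subtype.val : s → A)) at h2
  rw [h3, summable_const_iff] at h2
  exact hr (pow_eq_zero_iff two_ne_zero |>.1 h2)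

/-- A bounded function with a single nonzero Fourier coefficient is a multiple of a character. -/
theorem eq_smul_char (f : Lp ℂ ∞ μ) (a : A) (h : ∀ b, b ≠ a → M.coef f b = 0) :
    f = M.coef f a • M.char a := by
  classical
  refine M.ext_coef fun b => ?_
  rw [coef_smul, M.coef_char]
  split_ifs with hb
  · rw [hb, mul_one]
  · rw [h b hb, mul_zero]

theorem exists_coef_ne_zero {f : Lp ℂ ∞ μ} (hf : f ≠ 0) : ∃ a, M.coef f a ≠ 0 := by
  by_contra h
  push Not at h
  refine hf (M.ext_coef fun a => ?_)
  have : M.coef ((0 : ℂ) • f) a = 0 := by rw [coef_smul, zero_mul]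
  rw [zero_smul] at this
  rw [h, this]

/-- The convolution formula for the Fourier coefficients of a product. -/
theorem hasSum_coef_mul (f g : Lp ℂ ∞ μ) (a : A) :
    HasSum (fun b => M.coef f (a - b) * M.coef g b) (M.coef (f * g) a) := by
  -- Parseval's identity for the inner product of u_a · conj(f) with g.
  have h := M.basis.hasSum_inner_mul_inner (toL2 (M.char a * star f)) (toL2 g)
  have h1 : inner ℂ (toL2 (M.char a * star f)) (toL2 g) = M.coef (f * g) a := by
    rw [coef, inner_toL2, inner_toL2]
    refine integral_congr_ae ?_
    filter_upwards [coeFn_mul_Linfty (M.char a) (star f), Lp.coeFn_star f, coeFn_mul_Linfty f g]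
      with x h1 h2 h3
    rw [h1, h2, h3, Pi.star_apply, map_mul, Complex.star_def, Complex.conj_conj, mul_assoc]
  rw [h1] at h
  suffices hb : ∀ b, M.coef f (a - b) * M.coef g b =
      inner ℂ (toL2 (M.char a * star f)) (M.basis b) * inner ℂ (M.basis b) (toL2 g) by
    simpa only [hb] using h
  intro b
  rw [basis_apply, coef, coef, inner_toL2, inner_toL2 (M.char a * star f)]
  congr 1
  refine integral_congr_ae ?_
  filter_upwards [coeFn_mul_Linfty (M.char a) (star f), Lp.coeFn_star f, M.coeFn_char (a - b),
    M.coeFn_char a, M.coeFn_char b] with x h1 h2 h3 h4 h5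
  rw [h1, h2, h3, h4, h5, Pi.star_apply, map_mul, Complex.star_def, Complex.conj_conj, sub_eq_add_neg,
    M.u_add, M.u_neg, Circle.coe_mul, map_mul, Circle.coe_inv_eq_conj, Complex.conj_conj]
  ring

/-- Only one term of the convolution sum survives, so no cancellation can occur. -/
theorem coef_mul_of_unique {f g : Lp ℂ ∞ μ} {b c : A}
    (h : ∀ b' c', b' + c' = b + c → M.coef f b' ≠ 0 → M.coef g c' ≠ 0 → c' = c) :
    M.coef (f * g) (b + c) = M.coef f b * M.coef g c := by
  refine (M.hasSum_coef_mul f g (b + c)).unique ?_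
  have := hasSum_single (f := fun c' => M.coef f (b + c - c') * M.coef g c') c fun c' hc' => by
    by_contra hne
    exact hc' (h (b + c - c') c' (by abel) (left_ne_zero_of_mul hne) (right_ne_zero_of_mul hne))
  simpa using this

theorem map_char_ne_zero (π : AutLinfty μ) (a : A) : π (M.char a) ≠ 0 := by
  classical
  intro h0
  have h1 : M.char a = 0 := by
    rw [← StarAlgEquiv.symm_apply_apply π (M.char a), h0, map_zero]
  have h2 := M.coef_char a a
  rw [h1, if_pos rfl, ← zero_smul ℂ (M.char a), M.coef_smul, zero_mul] at h2
  exact zero_ne_one h2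

theorem smul_char_injective (a : A) {l l' : ℂ} (h : l • M.char a = l' • M.char a) : l = l' := by
  classical
  have := congrArg (fun f => M.coef f a) h
  simpa [M.coef_smul, M.coef_char] using this

/-- Level sets of a character of infinite order are null. -/
theorem measure_u_eq (a : A) (ha : ∀ n : ℕ, n ≠ 0 → n • a ≠ 0) (z : Circle) :
    μ {x | M.u a x = z} = 0 := by
  have hE : MeasurableSet {x | M.u a x = z} := by
    have : {x | M.u a x = z} = (fun x => (M.u a x : ℂ)) ⁻¹' {(z : ℂ)} := by
      ext x; simp [Circle.coe_inj]
    rw [this]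
    exact M.measurable_u a (measurableSet_singleton _)
  have hu : ∀ (n : ℕ) x, M.u (n • a) x = M.u a x ^ n := fun n x => by
    induction n with
    | zero => simp [M.u_zero]
    | succ n ih => rw [succ_nsmul, M.u_add, ih, pow_succ]
  have hinf : (range fun n : ℕ => n • a).Infinite := by
    refine infinite_range_of_injective fun m n hmn => ?_
    by_contra hne
    rcases lt_or_gt_of_ne hne with h | h
    · exact ha (n - m) (Nat.sub_ne_zero_of_lt h) (by
        rw [sub_nsmul _ h.le, ← hmn]; simp)
    · exact ha (m - n) (Nat.sub_ne_zero_of_lt h) (by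
        rw [sub_nsmul _ h.le, hmn]; simp)
  -- On the level set the character of n • a is the constant z^n, so infinitely many Fourier
  -- coefficients of the indicator have modulus equal to its measure.
  have key := M.coef_eq_zero_of_infinite (indLinfty hE) hinf (μ.real {x | M.u a x = z}) (by
    rintro - ⟨n, rfl⟩
    have : M.coef (indLinfty hE) (n • a)
        = ∫ x, {x | M.u a x = z}.indicator (fun _ => ((z ^ n)⁻¹ : ℂ)) x ∂μ := by
      rw [coef_eq_integral]
      refine integral_congr_ae ?_
      filter_upwards [coeFn_indLinfty (μ := μ) hE] with x h1
      rw [h1]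
      by_cases hx : x ∈ {x | M.u a x = z}
      · rw [indicator_of_mem hx, indicator_of_mem hx, mul_one, hu, ← Circle.coe_inv_eq_conj,
          show M.u a x = z from hx, Circle.coe_inv, Circle.coe_pow]
      · rw [indicator_of_notMem hx, indicator_of_notMem hx, mul_zero]
    rw [this, integral_indicator hE, setIntegral_const, norm_smul]
    simp [Circle.norm_coe])
  rwa [measureReal_eq_zero_iff] at key

end FourierModel

end Fourier

/-! ### The affine action on `ℤ²` and the module of finitely supported functions of sum zero -/

section AffineAction

open Matrix

/-- The affine action of `ℤ² ⋊ SL(2, ℤ)` on `ℤ²`. -/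
def affAct : Z2SL2 →* Equiv.Perm (Fin 2 → ℤ) :=
  MonoidHom.toHomPerm
    { toFun := fun g x => (g.right : Matrix (Fin 2) (Fin 2) ℤ) *ᵥ x + g.left.toAdd
      map_one' := by
        funext x
        simp only [SemidirectProduct.one_right, SemidirectProduct.one_left, toAdd_one, add_zero]
        exact one_mulVec x
      map_mul' := fun g h => by
        funext x
        have h1 : (slAction g.right h.left).toAdd =
          (g.right : Matrix (Fin 2) (Fin 2) ℤ) *ᵥ h.left.toAdd := rfl
        have h2 : ((g.right * h.right : SpecialLinearGroup (Fin 2) ℤ) : Matrix (Fin 2) (Fin 2) ℤ) *ᵥ x =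
          (g.right : Matrix (Fin 2) (Fin 2) ℤ) *ᵥ ((h.right : Matrix (Fin 2) (Fin 2) ℤ) *ᵥ x) :=
          (mulVec_mulVec _ _ _).symm
        simp only [SemidirectProduct.mul_right, SemidirectProduct.mul_left, toAdd_mul, h1, h2]
        change _ = (g.right : Matrix (Fin 2) (Fin 2) ℤ) *ᵥ
          ((h.right : Matrix (Fin 2) (Fin 2) ℤ) *ᵥ x + h.left.toAdd) + g.left.toAdd
        rw [mulVec_add]
        abel }

theorem affAct_apply (g : Z2SL2) (x : Fin 2 → ℤ) :
    affAct g x = (g.right : Matrix (Fin 2) (Fin 2) ℤ) *ᵥ x + g.left.toAdd := rfl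

theorem eq_one_of_affAct_eq_one {g : Z2SL2} (h : ∀ x, affAct g x = x) : g = 1 := by
  simp only [affAct_apply] at h
  have h0 : g.left.toAdd = 0 := by simpa using h 0
  have h1 : g.right = 1 := by
    ext i j
    have := congrFun (h (Pi.single j 1)) i
    rw [h0, add_zero, mulVec_single_one] at this
    exact this.trans (by simp [Pi.single_apply, Matrix.one_apply])
  exact SemidirectProduct.ext h0 h1

/-- The determinant pairing on `ℤ²`. -/
def det2 (v x : Fin 2 → ℤ) : ℤ := v 0 * x 1 - v 1 * x 0

theorem det2_mulVec (M : SpecialLinearGroup (Fin 2) ℤ) (v x : Fin 2 → ℤ) :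
    det2 ((M : Matrix (Fin 2) (Fin 2) ℤ) *ᵥ v) ((M : Matrix (Fin 2) (Fin 2) ℤ) *ᵥ x) =
      det2 v x := by
  have h := M.det_coe
  rw [det_fin_two] at h
  simp only [det2, mulVec, dotProduct, Fin.sum_univ_two]
  linear_combination (v 0 * x 1 - v 1 * x 0) * h

/-! ### Functions of sum zero and the edges that generate them -/

variable (B : Type*) [AddCommGroup B]

/-- The finitely supported functions `ℤ² → B` of sum zero. -/
noncomputable def sumZero : AddSubgroup ((Fin 2 → ℤ) →₀ B) :=
  (Finsupp.liftAddHom fun _ => AddMonoidHom.id B : ((Fin 2 → ℤ) →₀ B) →+ B).ker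

variable {B}

theorem mem_sumZero {a : (Fin 2 → ℤ) →₀ B} : a ∈ sumZero B ↔ (a.sum fun _ b => b) = 0 := Iff.rfl

/-- The difference of the point masses of weight `b` at `x` and at `y`. -/
noncomputable def edge (b : B) (x y : Fin 2 → ℤ) : sumZero B :=
  ⟨Finsupp.single x b - Finsupp.single y b, by
    rw [sumZero, AddMonoidHom.mem_ker, map_sub]
    simp⟩

theorem edge_add_edge (b : B) (x y z : Fin 2 → ℤ) : edge b x y + edge b y z = edge b x z :=
  Subtype.ext (sub_add_sub_cancel _ _ _)

theorem neg_edge (b : B) (x y : Fin 2 → ℤ) : -edge b x y = edge b y x :=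
  Subtype.ext (neg_sub _ _)

theorem edge_add (b b' : B) (x y : Fin 2 → ℤ) : edge (b + b') x y = edge b x y + edge b' x y :=
  Subtype.ext (by
    change Finsupp.single x (b + b') - Finsupp.single y (b + b') = (Finsupp.single x b -
      Finsupp.single y b) + (Finsupp.single x b' - Finsupp.single y b')
    rw [Finsupp.single_add, Finsupp.single_add]; abel)

theorem edge_apply (b : B) (x y z : Fin 2 → ℤ) :
    (edge b x y).1 z = (if x = z then b else 0) - if y = z then b else 0 := by
  change (Finsupp.single x b - Finsupp.single y b) z = _
  rw [Finsupp.sub_apply, Finsupp.single_apply, Finsupp.single_apply]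

/-- An element of sum zero that is supported on two points is an edge. -/
theorem eq_edge_of_support {a : sumZero B} {x y : Fin 2 → ℤ} (hxy : x ≠ y)
    (h : ∀ z, z ≠ x → z ≠ y → a.1 z = 0) : a = edge (a.1 x) x y := by
  have hs : (Finsupp.liftAddHom fun _ => AddMonoidHom.id B : ((Fin 2 → ℤ) →₀ B) →+ B) a.1 = 0 := a.2
  have h2 : a.1 = Finsupp.single x (a.1 x) + Finsupp.single y (a.1 y) := by
    ext z
    rw [Finsupp.add_apply, Finsupp.single_apply, Finsupp.single_apply]
    by_cases hx : x = z
    · subst hx; simp [hxy.symm]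
    · by_cases hy : y = z
      · subst hy; simp [hx]
      · simp [hx, hy, h z (Ne.symm hx) (Ne.symm hy)]
  rw [h2, map_add] at hs
  simp only [Finsupp.liftAddHom_apply_single, AddMonoidHom.id_apply] at hs
  apply Subtype.ext
  change a.1 = Finsupp.single x (a.1 x) - Finsupp.single y (a.1 x)
  conv_lhs => rw [h2]
  rw [sub_eq_add_neg, ← Finsupp.single_neg, eq_neg_of_add_eq_zero_right hs]

theorem eq_zero_of_support {a : sumZero B} {x : Fin 2 → ℤ} (h : ∀ z, z ≠ x → a.1 z = 0) : a = 0 := by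
  obtain ⟨y, hy⟩ := exists_ne x
  have h1 := eq_edge_of_support hy.symm fun z hz _ => h z hz
  have h2 : a.1 x = 0 := by
    have := congrArg (fun c : sumZero B => c.1 y) h1
    simp only [edge_apply, if_neg hy.symm, h y hy, if_true, zero_sub] at this
    exact (neg_eq_zero.1 this.symm)
  apply Subtype.ext
  ext z
  by_cases hz : z = x
  · rw [hz, h2]; rfl
  · rw [h z hz]; rfl

theorem edge_mem_induction (K : AddSubgroup (sumZero B)) (h : ∀ b x, edge b x 0 ∈ K)
    (a : sumZero B) : a ∈ K := by
  classical
  have key : a = ∑ x ∈ a.1.support, edge (a.1 x) x 0 := by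
    have hs : ∑ x ∈ a.1.support, a.1 x = 0 := a.2
    apply Subtype.ext
    rw [AddSubgroup.val_finsetSum]
    have h1 : ∀ x, (edge (a.1 x) x 0).1 = Finsupp.single x (a.1 x) - Finsupp.single 0 (a.1 x) :=
      fun _ => rfl
    simp only [h1, Finset.sum_sub_distrib]
    rw [← Finsupp.single_finsetSum, hs, Finsupp.single_zero, sub_zero]
    exact a.1.sum_single.symm
  rw [key]
  exact K.sum_mem fun x _ => h _ _

theorem sumZero_hom_ext {C : Type*} [AddGroup C] {f g : sumZero B →+ C}
    (h : ∀ b x y, f (edge b x y) = g (edge b x y)) : f = g := by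
  ext a
  exact edge_mem_induction (f.eqLocus g) (fun b x => h b x 0) a

/-- Permutations of `ℤ²` act on the functions of sum zero. -/
noncomputable def permSumZero (e : Equiv.Perm (Fin 2 → ℤ)) : sumZero B ≃+ sumZero B where
  toFun a := ⟨Finsupp.domCongr e a.1, by
    have h := a.2
    rw [mem_sumZero] at h ⊢
    rw [← h]
    exact Finsupp.sum_equivMapDomain _ _ _⟩
  invFun a := ⟨Finsupp.domCongr e.symm a.1, by
    have h := a.2
    rw [mem_sumZero] at h ⊢
    rw [← h]
    exact Finsupp.sum_equivMapDomain _ _ _⟩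
  left_inv a := Subtype.ext (by ext; simp)
  right_inv a := Subtype.ext (by ext; simp)
  map_add' a b := Subtype.ext (map_add _ _ _)

theorem permSumZero_apply (e : Equiv.Perm (Fin 2 → ℤ)) (a : sumZero B) (x : Fin 2 → ℤ) :
    (permSumZero e a).1 x = a.1 (e.symm x) := rfl

theorem permSumZero_edge (e : Equiv.Perm (Fin 2 → ℤ)) (b : B) (x y : Fin 2 → ℤ) :
    permSumZero e (edge b x y) = edge b (e x) (e y) := by
  apply Subtype.ext
  ext z
  rw [permSumZero_apply, edge_apply, edge_apply]
  simp only [Equiv.eq_symm_apply]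

theorem permSumZero_mul (e e' : Equiv.Perm (Fin 2 → ℤ)) (a : sumZero B) :
    permSumZero (e * e') a = permSumZero e (permSumZero e' a) :=
  Subtype.ext (Finsupp.ext fun _ => rfl)

/-- Finitely many translates of a would have finitely many support points in total, yet every e n x
is one of them. -/
theorem infinite_range_permSumZero (e : ℕ → Equiv.Perm (Fin 2 → ℤ)) (a : sumZero B)
    {x : Fin 2 → ℤ} (hx : a.1 x ≠ 0) (he : Function.Injective fun n => e n x) :
    (Set.range fun n => permSumZero (e n) a).Infinite := by
  intro hfin
  have h1 : (⋃ c ∈ Set.range fun n => permSumZero (e n) a, (c.1.support : Set (Fin 2 → ℤ))).Finite :=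
    hfin.biUnion fun c _ => c.1.support.finite_toSet
  refine Set.infinite_range_of_injective he (h1.subset ?_)
  rintro - ⟨n, rfl⟩
  refine Set.mem_biUnion (Set.mem_range_self n) ?_
  simpa [permSumZero_apply] using hx

/-! ### The flux and its cocycle identity -/

/-- The flux of a function of sum zero in the direction `v`. -/
noncomputable def flux (p : B →+ ℤ) (v : Fin 2 → ℤ) : sumZero B →+ ℤ :=
  (Finsupp.liftAddHom fun x => (AddMonoidHom.mulRight (det2 v x)).comp p).comp (sumZero B).subtype

theorem flux_edge (p : B →+ ℤ) (v : Fin 2 → ℤ) (b : B) (x y : Fin 2 → ℤ) :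
    flux p v (edge b x y) = p b * (det2 v x - det2 v y) := by
  change (Finsupp.liftAddHom fun x => (AddMonoidHom.mulRight (det2 v x)).comp p)
    (Finsupp.single x b - Finsupp.single y b) = _
  rw [map_sub]
  simp [mul_sub]

/-- For g = (v, S) and h = (w, T), expand det(v + Sw, Sx + v). Besides det(v, Sx + v) and det(Sw,
Sx) = det(w, x), it contains det(Sw, v), which does not depend on x and cancels in the difference
over an edge. -/
theorem flux_cocycle (p : B →+ ℤ) (g h : Z2SL2) (a : sumZero B) :
    flux p (g * h).left.toAdd (permSumZero (affAct (g * h)) a) =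
      flux p h.left.toAdd (permSumZero (affAct h) a) +
        flux p g.left.toAdd (permSumZero (affAct g) (permSumZero (affAct h) a)) := by
  have key : ∀ c : sumZero B, flux p (g * h).left.toAdd (permSumZero (affAct g) c) =
      flux p h.left.toAdd c + flux p g.left.toAdd (permSumZero (affAct g) c) := by
    intro c
    refine DFunLike.congr_fun (f := (flux p (g * h).left.toAdd).comp
      (permSumZero (affAct g)).toAddMonoidHom) (g := flux p h.left.toAdd +
        (flux p g.left.toAdd).comp (permSumZero (affAct g)).toAddMonoidHom)
      (sumZero_hom_ext fun b x y => ?_) c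
    simp only [AddMonoidHom.comp_apply, AddMonoidHom.add_apply, AddEquiv.coe_toAddMonoidHom,
      permSumZero_edge, flux_edge]
    have hl : (g * h).left.toAdd =
        g.left.toAdd + (g.right : Matrix (Fin 2) (Fin 2) ℤ) *ᵥ h.left.toAdd := rfl
    have hx := det2_mulVec g.right h.left.toAdd x
    have hy := det2_mulVec g.right h.left.toAdd y
    rw [hl, affAct_apply, affAct_apply]
    simp only [det2, Pi.add_apply] at hx hy ⊢
    linear_combination p b * hx - p b * hy
  rw [map_mul, permSumZero_mul, key]

end AffineAction

/-! ### Automorphisms of `L^∞` induced by affine maps of the dual -/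

section AffineAut

open Set Filter

namespace FourierModel

variable {A : Type*} [AddCommGroup A] {X : Type*} [MeasurableSpace X] {μ : Measure X}
  (M : FourierModel A μ)

/-- The transformation of the underlying space with `u a ∘ T = c a • u (φ a)`. -/
noncomputable def affineEquiv (φ : A ≃+ A) (c : Multiplicative A →* Circle) : X ≃ᵐ X :=
  (M.exists_affine φ (fun a => c (.ofAdd a)) fun a b => by rw [ofAdd_add, map_mul]).choose

theorem measurePreserving_affineEquiv (φ : A ≃+ A) (c : Multiplicative A →* Circle) :
    MeasurePreserving (M.affineEquiv φ c) μ μ :=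
  (M.exists_affine φ (fun a => c (.ofAdd a)) fun a b => by rw [ofAdd_add, map_mul]).choose_spec.1

theorem u_affineEquiv (φ : A ≃+ A) (c : Multiplicative A →* Circle) (a : A) (x : X) :
    M.u a (M.affineEquiv φ c x) = c (.ofAdd a) * M.u (φ a) x :=
  (M.exists_affine φ (fun a => c (.ofAdd a)) fun a b => by
    rw [ofAdd_add, map_mul]).choose_spec.2 a x

/-- The automorphism of `L^∞` that maps the character `u a` to `c a • u (φ a)`. -/
noncomputable def affineAut (φ : A ≃+ A) (c : Multiplicative A →* Circle) : AutLinfty μ :=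
  compAut (M.affineEquiv φ c) (M.measurePreserving_affineEquiv φ c)

theorem affineAut_char (φ : A ≃+ A) (c : Multiplicative A →* Circle) (a : A) :
    M.affineAut φ c (M.char a) = (c (.ofAdd a) : ℂ) • M.char (φ a) := by
  apply Lp.ext
  filter_upwards [coeFn_compAut _ (M.measurePreserving_affineEquiv φ c) (M.char a),
    (M.measurePreserving_affineEquiv φ c).quasiMeasurePreserving.ae_eq_comp (M.coeFn_char a),
    Lp.coeFn_smul (c (.ofAdd a) : ℂ) (M.char (φ a)), M.coeFn_char (φ a)] with x h1 h2 h3 h4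
  rw [affineAut, h1, h3, Pi.smul_apply, h4, smul_eq_mul, ← Circle.coe_mul, ← M.u_affineEquiv]
  exact h2

theorem integral_affineAut (φ : A ≃+ A) (c : Multiplicative A →* Circle) (f : Lp ℂ ∞ μ) :
    ∫ x, M.affineAut φ c f x ∂μ = ∫ x, f x ∂μ := by
  rw [affineAut, integral_congr_ae (coeFn_compAut _ (M.measurePreserving_affineEquiv φ c) f)]
  exact (M.measurePreserving_affineEquiv φ c).integral_comp' (f := M.affineEquiv φ c) f

variable [IsProbabilityMeasure μ]

theorem coef_affineAut (φ : A ≃+ A) (c : Multiplicative A →* Circle) (f : Lp ℂ ∞ μ) (a : A) :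
    M.coef (M.affineAut φ c f) (φ a) = c (.ofAdd a) * M.coef f a := by
  rw [coef_eq_integral, coef_eq_integral, ← integral_const_mul,
    ← (M.measurePreserving_affineEquiv φ c).integral_comp' (f := M.affineEquiv φ c)
      fun x => (c (.ofAdd a) : ℂ) * ((starRingEnd ℂ) (M.u a x : ℂ) * f x)]
  refine integral_congr_ae ?_
  filter_upwards [coeFn_compAut _ (M.measurePreserving_affineEquiv φ c) f] with x h1
  rw [affineAut, h1, M.u_affineEquiv, Circle.coe_mul, map_mul, ← Circle.coe_inv_eq_conj (c _),
    ← mul_assoc, ← mul_assoc, ← Circle.coe_mul, mul_inv_cancel, Circle.coe_one, one_mul]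

theorem norm_coef_affineAut (φ : A ≃+ A) (c : Multiplicative A →* Circle) (f : Lp ℂ ∞ μ) (a : A) :
    ‖M.coef (M.affineAut φ c f) (φ a)‖ = ‖M.coef f a‖ := by
  rw [coef_affineAut, norm_mul, Circle.norm_coe, one_mul]

end FourierModel

end AffineAut

/-! ### The twisted action and the rigidity of its intertwiners -/

section TwistedAction

open Set Filter Matrix

variable {B : Type*} [AddCommGroup B]

/-- The cocycle by which the action is twisted. -/
noncomputable def twist (p : B →+ ℤ) (t : Circle) (g : Z2SL2) :
    Multiplicative (sumZero B) →* Circle :=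
  (zpowersHom Circle t).comp (AddMonoidHom.toMultiplicative
    ((flux p g.left.toAdd).comp (permSumZero (affAct g)).toAddMonoidHom))

theorem twist_apply (p : B →+ ℤ) (t : Circle) (g : Z2SL2) (a : sumZero B) :
    twist p t g (.ofAdd a) = t ^ flux p g.left.toAdd (permSumZero (affAct g) a) := rfl

/-- The element `x ↦ (a x₀ + b x₁ + r, c x₀ + d x₁ + s)` of `ℤ² ⋊ SL(2, ℤ)`. -/
def affElt (a b c d : ℤ) (h : a * d - b * c = 1) (r s : ℤ) : Z2SL2 :=
  ⟨Multiplicative.ofAdd ![r, s], ⟨!![a, b; c, d], by rw [det_fin_two_of, h]⟩⟩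

theorem affAct_affElt (a b c d : ℤ) (h : a * d - b * c = 1) (r s : ℤ) (x : Fin 2 → ℤ) :
    affAct (affElt a b c d h r s) x = ![a * x 0 + b * x 1 + r, c * x 0 + d * x 1 + s] := by
  have h1 : affAct (affElt a b c d h r s) x = !![a, b; c, d] *ᵥ x + ![r, s] := rfl
  rw [h1]
  ext i
  fin_cases i <;> simp [dotProduct, Fin.sum_univ_two]

variable {X : Type*} [MeasurableSpace X] [StandardBorelSpace X] {μ : Measure X}
  [Countable B] (M : FourierModel (sumZero B) μ)

/-- The twisted action of `ℤ² ⋊ SL(2, ℤ)`. -/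
noncomputable def twistedAction (p : B →+ ℤ) (t : Circle) : Z2SL2 →* AutLinfty μ :=
  MonoidHom.mk' (fun g => M.affineAut (permSumZero (affAct g)) (twist p t g)) fun g h => by
    have : Countable (sumZero B) := inferInstance
    refine M.aut_ext fun a => ?_
    rw [StarAlgEquiv.mul_apply, M.affineAut_char, M.affineAut_char, map_smul, M.affineAut_char,
      smul_smul, ← Circle.coe_mul, twist_apply, twist_apply, twist_apply, flux_cocycle, _root_.zpow_add,
      map_mul, permSumZero_mul]

theorem twistedAction_apply (p : B →+ ℤ) (t : Circle) (g : Z2SL2) :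
    twistedAction M p t g = M.affineAut (permSumZero (affAct g)) (twist p t g) := rfl

theorem twistedAction_char (p : B →+ ℤ) (t : Circle) (g : Z2SL2) (a : sumZero B) :
    twistedAction M p t g (M.char a) =
      ((t ^ flux p g.left.toAdd (permSumZero (affAct g) a) : Circle) : ℂ) •
        M.char (permSumZero (affAct g) a) := by
  rw [twistedAction_apply, M.affineAut_char, twist_apply]

theorem isTracePreserving_twistedAction (p : B →+ ℤ) (t : Circle) :
    IsTracePreserving (twistedAction M p t) := fun _ f => M.integral_affineAut _ _ f

/-- At a fixed point of g, the character of ga − a takes a prescribed value. With a an edge at a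
point moved by g, the element ga − a has infinite order, so the level set is null. -/
theorem isEssentiallyFree_twistedAction [IsProbabilityMeasure μ] (p : B →+ ℤ) (t : Circle) (b : B)
    (hb : ∀ n : ℕ, n ≠ 0 → n • b ≠ 0) : IsEssentiallyFree (twistedAction M p t) := by
  intro g hg
  have hR := M.measurePreserving_affineEquiv (permSumZero (affAct g)) (twist p t g)
  set R := M.affineEquiv (permSumZero (affAct g)) (twist p t g)
  refine ⟨R.symm, hR.symm R, fun f => coeFn_compAut R hR f, ?_⟩
  obtain ⟨x, hx⟩ : ∃ x, affAct g x ≠ x := by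
    by_contra h
    push Not at h
    exact hg (eq_one_of_affAct_eq_one h)
  obtain ⟨y, hy⟩ := exists_ne x
  set a := edge b x y
  refine measure_mono_null (fun z hz => ?_) (M.measure_u_eq (permSumZero (affAct g) a - a)
    (fun n hn h => ?_) (twist p t g (.ofAdd a))⁻¹)
  · have hz' : R z = z := by
      conv_lhs => rw [← show R.symm z = z from hz]
      exact R.apply_symm_apply z
    have h1 := M.u_affineEquiv (permSumZero (affAct g)) (twist p t g) a z
    change M.u a (R z) = _ at h1
    rw [hz'] at h1
    change M.u _ z = _
    rw [sub_eq_add_neg, M.u_add, M.u_neg, h1, mul_inv, mul_comm, mul_assoc, inv_mul_cancel, mul_one]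
  · have h1 : (n • (permSumZero (affAct g) a - a)).1 x = 0 := by rw [h]; rfl
    rw [permSumZero_edge] at h1
    have h2 : (n • (edge b (affAct g x) (affAct g y) - edge b x y)).1 x =
      n • ((edge b (affAct g x) (affAct g y)).1 x - (edge b x y).1 x) := rfl
    rw [h2, edge_apply, edge_apply, if_neg hx, if_pos rfl, if_neg hy] at h1
    split_ifs at h1
    -- Here g maps y to x, so ga − a takes the value −2b at x; otherwise the value is −b.
    · refine hb (n * 2) (by positivity) ?_
      rw [mul_nsmul, two_nsmul, ← neg_eq_zero, ← h1]
      simp only [sub_zero, zero_sub, smul_sub, smul_neg]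
      abel
    · exact hb n hn (by simpa using h1)

/-- The coefficients of an invariant function have constant modulus along orbits, and translations
already move every nonzero a through infinitely many elements. -/
theorem isErgodicAction_twistedAction [IsProbabilityMeasure μ] (p : B →+ ℤ) (t : Circle) :
    IsErgodicAction (twistedAction M p t) := by
  intro f hf
  have key : ∀ a, a ≠ 0 → M.coef f a = 0 := by
    intro a ha
    obtain ⟨x, hx⟩ : ∃ x, a.1 x ≠ 0 := by
      by_contra h
      push Not at h
      exact ha (Subtype.ext (Finsupp.ext h))
    let g : ℕ → Z2SL2 := fun n => affElt 1 0 0 1 (by norm_num) n 0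
    have hinf := infinite_range_permSumZero (fun n => affAct (g n)) a hx fun m n hmn => by
      have := congrFun hmn 0
      simpa [g, affAct_affElt] using this
    have := M.coef_eq_zero_of_infinite f hinf ‖M.coef f a‖ (by
      rintro - ⟨n, rfl⟩
      conv_lhs => rw [← hf (g n)]
      exact M.norm_coef_affineAut _ _ _ _)
    exact norm_eq_zero.1 this
  have h := M.eq_smul_char f 0 key
  refine ⟨M.coef f 0, ?_⟩
  rw [h]
  filter_upwards [Lp.coeFn_smul (M.coef f 0) (M.char 0), M.coeFn_char 0] with x h1 h2
  rw [h1, Pi.smul_apply, h2, M.u_zero, Circle.coe_one, smul_eq_mul, mul_one, ← h]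

/-! ### Intertwiners of two twisted actions -/

section Intertwiner

variable {p : B →+ ℤ} {t t' : Circle} {π : AutLinfty μ}

theorem intertwiner_char_perm
    (h : ∀ g f, π (twistedAction M p t g f) = twistedAction M p t' g (π f))
    (g : Z2SL2) (a : sumZero B) :
    π (M.char (permSumZero (affAct g) a)) =
      (((t ^ flux p g.left.toAdd (permSumZero (affAct g) a))⁻¹ : Circle) : ℂ) •
        twistedAction M p t' g (π (M.char a)) := by
  rw [← h, twistedAction_char, map_smul, smul_smul, ← Circle.coe_mul, inv_mul_cancel,
    Circle.coe_one, one_smul]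

/-- The translation part of g is g0, so the first endpoint contributes nothing to the flux and only
det(g0, g(1,0)) remains in the exponents. -/
theorem intertwiner_char_edge_affElt
    (h : ∀ g f, π (twistedAction M p t g f) = twistedAction M p t' g (π f)) {b b' : B} {l : ℂ}
    (hb : π (M.char (edge b 0 ![1, 0])) = l • M.char (edge b' 0 ![1, 0])) (g : Z2SL2) :
    π (M.char (edge b (affAct g 0) (affAct g ![1, 0]))) =
      (l * ((t ^ (p b * det2 (affAct g 0) (affAct g ![1, 0])) *
        (t' ^ (p b' * det2 (affAct g 0) (affAct g ![1, 0])))⁻¹ : Circle) : ℂ)) •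
        M.char (edge b' (affAct g 0) (affAct g ![1, 0])) := by
  have h0 : g.left.toAdd = affAct g 0 := by rw [affAct_apply, mulVec_zero, zero_add]
  have hd : det2 (affAct g 0) (affAct g 0) = 0 := by rw [det2, mul_comm, sub_self]
  rw [← permSumZero_edge, intertwiner_char_perm M h, hb, map_smul, twistedAction_char, smul_smul,
    smul_smul, permSumZero_edge, permSumZero_edge, flux_edge, flux_edge, h0, hd, zero_sub, mul_neg,
    mul_neg, _root_.zpow_neg, _root_.zpow_neg, inv_inv, Circle.coe_mul]
  congr 1
  ring

variable [IsProbabilityMeasure μ]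

theorem intertwiner_coef_ne_zero
    (h : ∀ g f, π (twistedAction M p t g f) = twistedAction M p t' g (π f))
    (g : Z2SL2) (a c : sumZero B) :
    M.coef (π (M.char (permSumZero (affAct g) a))) (permSumZero (affAct g) c) ≠ 0 ↔
      M.coef (π (M.char a)) c ≠ 0 := by
  rw [← norm_ne_zero_iff, ← norm_ne_zero_iff (a := M.coef (π (M.char a)) c),
    intertwiner_char_perm M h, M.coef_smul, norm_mul, Circle.norm_coe, one_mul, twistedAction_apply,
    M.norm_coef_affineAut]

/-- The linear shears along the first axis fix the edge and have zero flux, so they fix its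
character and hence its image under π. They move any point off that axis to infinitely many places.
-/
theorem intertwiner_support
    (h : ∀ g f, π (twistedAction M p t g f) = twistedAction M p t' g (π f))
    (b : B) (a : sumZero B) (ha : M.coef (π (M.char (edge b 0 ![1, 0]))) a ≠ 0)
    (x : Fin 2 → ℤ) (hx : a.1 x ≠ 0) : x 1 = 0 := by
  by_contra hx1
  let g : ℕ → Z2SL2 := fun n => affElt 1 n 0 1 (by ring) 0 0
  have hinf := infinite_range_permSumZero (fun n => affAct (g n)) a hx fun m n hmn => by
    have := congrFun hmn 0
    simpa [g, affAct_affElt, hx1] using this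
  have hfix : ∀ n, permSumZero (affAct (g n)) (edge b 0 ![1, 0]) = edge b 0 ![1, 0] := by
    intro n
    rw [permSumZero_edge]
    congr 1 <;> ext i <;> fin_cases i <;> simp [g, affAct_affElt]
  refine ha (norm_eq_zero.1 (M.coef_eq_zero_of_infinite (π (M.char (edge b 0 ![1, 0]))) hinf _ ?_))
  rintro - ⟨n, rfl⟩
  have h1 := h (g n) (M.char (edge b 0 ![1, 0]))
  have h2 : flux p (g n).left.toAdd (edge b 0 ![1, 0]) = 0 := by
    rw [flux_edge]
    simp [g, affElt, det2]
  rw [twistedAction_char, hfix, h2, zpow_zero, Circle.coe_one, one_smul] at h1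
  conv_lhs => rw [h1]
  exact M.norm_coef_affineAut _ _ _ _

theorem intertwiner_support_affElt
    (h : ∀ g f, π (twistedAction M p t g f) = twistedAction M p t' g (π f))
    (b : B) (g : Z2SL2) (c : sumZero B)
    (hc : M.coef (π (M.char (edge b (affAct g 0) (affAct g ![1, 0])))) c ≠ 0)
    (x : Fin 2 → ℤ) (hx : c.1 (affAct g x) ≠ 0) : x 1 = 0 := by
  obtain ⟨c, rfl⟩ := (permSumZero (affAct g)).surjective c
  rw [← permSumZero_edge, intertwiner_coef_ne_zero M h] at hc
  refine intertwiner_support M h b c hc x ?_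
  rwa [permSumZero_apply, Equiv.symm_apply_apply] at hx

/-- An intertwiner maps the characters of an edge to multiples of such characters. -/
theorem intertwiner_char_edge
    (h : ∀ g f, π (twistedAction M p t g f) = twistedAction M p t' g (π f)) (b : B) :
    ∃ (b' : B) (l : ℂ), l ≠ 0 ∧
      π (M.char (edge b 0 ![1, 0])) = l • M.char (edge b' 0 ![1, 0]) := by
  set f₁ := π (M.char (edge b 0 ![1, 0]))
  set f₂ := π (M.char (edge b ![1, 0] ![1, 1]))
  -- The triangle 0, (1,0), (1,1): each of f₁, f₂ and f₁f₂ has Fourier support in functions living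
  -- on the line through its own side.
  have h₃ : π (M.char (edge b 0 ![1, 1])) = f₁ * f₂ := by
    rw [← edge_add_edge b 0 ![1, 0] ![1, 1], M.char_add, map_mul]
  have supp₁ : ∀ c, M.coef f₁ c ≠ 0 → ∀ x, x 1 ≠ 0 → c.1 x = 0 := fun c hc x hx =>
    not_not.1 fun hcx => hx (intertwiner_support M h b c hc x hcx)
  have supp₂ : ∀ c, M.coef f₂ c ≠ 0 → ∀ x, x 0 ≠ 1 → c.1 x = 0 := by
    intro c hc x hx
    by_contra hcx
    have := intertwiner_support_affElt M h b (affElt 0 (-1) 1 0 (by norm_num) 1 0) c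
      (by
        convert hc using 5 <;> ext i <;> fin_cases i <;> simp [affAct_affElt]) ![x 1, 1 - x 0]
      (by
        convert hcx using 3; ext i; fin_cases i <;> simp [affAct_affElt])
    simp only [cons_val_one, cons_val_fin_one] at this
    omega
  have supp₃ : ∀ c, M.coef (f₁ * f₂) c ≠ 0 → ∀ x, x 0 ≠ x 1 → c.1 x = 0 := by
    intro c hc x hx
    by_contra hcx
    rw [← h₃] at hc
    have := intertwiner_support_affElt M h b (affElt 1 0 1 1 (by norm_num) 0 0) c
      (by
        convert hc using 5 <;> ext i <;> fin_cases i <;> simp [affAct_affElt]) ![x 0, x 1 - x 0]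
      (by
        convert hcx using 3; ext i; fin_cases i <;> simp [affAct_affElt])
    simp only [cons_val_one, cons_val_fin_one] at this
    omega
  have hne : ∀ x : Fin 2 → ℤ, x ≠ ![1, 0] → x 1 ≠ 0 ∨ x 0 ≠ 1 := by
    intro x hx
    by_contra hcon
    push Not at hcon
    exact hx (by ext i; fin_cases i <;> simp [hcon])
  have main : ∀ c₁ c₂, M.coef f₁ c₁ ≠ 0 → M.coef f₂ c₂ ≠ 0 →
      c₁ = edge (-c₂.1 ![1, 1]) 0 ![1, 0] := by
    intro c₁ c₂ hc₁ hc₂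
    -- The first two lines meet only at (1,0). Two decompositions of c₁ + c₂ hence differ by an
    -- element supported at one point, which vanishes because its sum is zero.
    have h12 : M.coef (f₁ * f₂) (c₁ + c₂) ≠ 0 := by
      rw [M.coef_mul_of_unique]
      · exact mul_ne_zero hc₁ hc₂
      · intro d₁ d₂ hd hd₁ hd₂
        rw [← sub_eq_zero]
        refine eq_zero_of_support (x := ![1, 0]) fun z hz => ?_
        rcases hne z hz with h1 | h0
        · have : d₂ - c₂ = c₁ - d₁ := by
            rw [sub_eq_sub_iff_add_eq_add, add_comm d₂, hd]
          rw [this]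
          change c₁.1 z - d₁.1 z = 0
          rw [supp₁ c₁ hc₁ z h1, supp₁ d₁ hd₁ z h1, sub_zero]
        · change d₂.1 z - c₂.1 z = 0
          rw [supp₂ c₂ hc₂ z h0, supp₂ d₂ hd₂ z h0, sub_zero]
    -- So c₁ + c₂ lives on the diagonal, which leaves c₁ and c₂ only the vertices of the triangle.
    -- The condition at (1,0), off the diagonal, relates their weights.
    have hsum : ∀ x : Fin 2 → ℤ, x 0 ≠ x 1 → c₁.1 x + c₂.1 x = 0 := supp₃ _ h12
    have e₁ : c₁ = edge (c₁.1 0) 0 ![1, 0] := by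
      refine eq_edge_of_support (fun h0 => by simpa using congrFun h0 0) fun z hz0 hz1 => ?_
      by_cases hz : z 1 = 0
      · have hz0' : z 0 ≠ 0 := fun h0 => hz0 (by ext i; fin_cases i <;> simp [hz, h0])
        have hz1' : z 0 ≠ 1 := (hne z hz1).resolve_left (not_not.2 hz)
        have := hsum z (by rwa [hz])
        rwa [supp₂ c₂ hc₂ z hz1', add_zero] at this
      · exact supp₁ c₁ hc₁ z hz
    have e₂ : c₂ = edge (c₂.1 ![1, 1]) ![1, 1] ![1, 0] := by
      refine eq_edge_of_support (fun h0 => by simpa using congrFun h0 1) fun z hz1 hz0 => ?_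
      by_cases hz : z 0 = 1
      · have hz' : z 1 ≠ 0 := (hne z hz0).resolve_right (not_not.2 hz)
        have hz'' : z 0 ≠ z 1 := fun h0 => hz1 (by ext i; fin_cases i <;> simp [hz, ← h0])
        have := hsum z hz''
        rwa [supp₁ c₁ hc₁ z hz', zero_add] at this
      · exact supp₂ c₂ hc₂ z hz
    have e₃ := hsum ![1, 0] (by simp)
    rw [e₁, e₂, edge_apply, edge_apply] at e₃
    have n1 : (0 : Fin 2 → ℤ) ≠ ![1, 0] := fun h0 => by simpa using congrFun h0 0
    have n2 : (![1, 1] : Fin 2 → ℤ) ≠ ![1, 0] := fun h0 => by simpa using congrFun h0 1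
    rw [if_neg n1, if_neg n2, if_pos rfl, if_pos rfl, zero_sub, zero_sub] at e₃
    have e₄ : c₁.1 0 = -c₂.1 ![1, 1] := by
      rw [← neg_eq_iff_eq_neg, eq_comm, ← sub_eq_zero, ← neg_eq_zero, ← e₃]
      abel
    rwa [e₄] at e₁
  -- With c₂ fixed, `main` shows that every element of the Fourier support of f₁ is the same edge.
  obtain ⟨c₁, hc₁⟩ := M.exists_coef_ne_zero (M.map_char_ne_zero π (edge b 0 ![1, 0]))
  obtain ⟨c₂, hc₂⟩ := M.exists_coef_ne_zero (M.map_char_ne_zero π (edge b ![1, 0] ![1, 1]))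
  refine ⟨-c₂.1 ![1, 1], _, ?_, M.eq_smul_char f₁ _ fun d hd => ?_⟩
  · rw [← main c₁ c₂ hc₁ hc₂]
    exact hc₁
  · by_contra hne
    exact hd (main d c₂ hne hc₂)

/-- The scalars in the action of an intertwiner on edges. -/
theorem intertwiner_scalar
    (h : ∀ g f, π (twistedAction M p t g f) = twistedAction M p t' g (π f)) {b b' : B} {l : ℂ}
    (hl : l ≠ 0) (hb : π (M.char (edge b 0 ![1, 0])) = l • M.char (edge b' 0 ![1, 0])) :
    l = ((t ^ p b)⁻¹ * t' ^ p b' : Circle) ∧ (t ^ p b) ^ 2 = (t' ^ p b') ^ 2 := by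
  have gen := intertwiner_char_edge_affElt M h hb
  have tri : ∀ (x : Fin 2 → ℤ) (s₂ s₃ : ℂ),
      π (M.char (edge b ![1, 0] x)) = s₂ • M.char (edge b' ![1, 0] x) →
      π (M.char (edge b 0 x)) = s₃ • M.char (edge b' 0 x) → s₃ = l * s₂ := by
    intro x s₂ s₃ h₂ h₃
    rw [← edge_add_edge b 0 ![1, 0] x, M.char_add, map_mul, hb, h₂, Linfty_smul_mul,
      Linfty_mul_smul, ← M.char_add, edge_add_edge, smul_smul] at h₃
    exact (M.smul_char_injective _ h₃).symm
  -- The triangles with third vertex (1,1) and (1,−1) have determinants +1 and −1. They yield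
  -- l·t^{p(b)} = t'^{p(b')} and the same relation with both powers exchanged.
  have g₂ := gen (affElt 0 (-1) 1 0 (by norm_num) 1 0)
  have g₃ := gen (affElt 1 0 1 1 (by norm_num) 0 0)
  have g₂' := gen (affElt 0 1 (-1) 0 (by norm_num) 1 0)
  have g₃' := gen (affElt 1 0 (-1) 1 (by norm_num) 0 0)
  have z : (![0, 0] : Fin 2 → ℤ) = 0 := by ext i; fin_cases i <;> rfl
  simp [affAct_affElt, det2, z] at g₂ g₃ g₂' g₃'
  have t₁ := tri _ _ _ g₂ g₃
  have t₂ := tri _ _ _ g₂' g₃'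
  have hx : ((t : ℂ) ^ p b) ≠ 0 := zpow_ne_zero _ t.coe_ne_zero
  have hy : ((t' : ℂ) ^ p b') ≠ 0 := zpow_ne_zero _ t'.coe_ne_zero
  have e₁ : l * (t : ℂ) ^ p b = (t' : ℂ) ^ p b' := by
    field_simp at t₁
    exact t₁.symm
  have e₂ : l * (t' : ℂ) ^ p b' = (t : ℂ) ^ p b := by
    field_simp at t₂
    exact t₂.symm
  refine ⟨?_, Circle.ext ?_⟩
  · rw [Circle.coe_mul, Circle.coe_inv, Circle.coe_zpow, Circle.coe_zpow, ← e₁]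
    field_simp
  · rw [Circle.coe_pow, Circle.coe_pow, Circle.coe_zpow, Circle.coe_zpow]
    calc ((t : ℂ) ^ p b) ^ 2 = (l * (t' : ℂ) ^ p b') * (t : ℂ) ^ p b := by rw [e₂]; ring
      _ = (l * (t : ℂ) ^ p b) * (t' : ℂ) ^ p b' := by ring
      _ = ((t' : ℂ) ^ p b') ^ 2 := by rw [e₁]; ring

end Intertwiner

end TwistedAction

/-! ### The centralizer of the twisted action -/

section Centralizer

open Set Filter Matrix Topology

section General

variable {B : Type*} [AddCommGroup B]

theorem sum_mapRange_addEquiv (σ : B ≃+ B) (a : (Fin 2 → ℤ) →₀ B) :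
    ((Finsupp.mapRange.addEquiv σ a).sum fun _ b => b) = σ (a.sum fun _ b => b) := by
  rw [map_finsuppSum]
  exact Finsupp.sum_mapRange_index (hf := map_zero σ) fun _ => rfl

/-- Automorphisms of the coefficient group act on the functions of sum zero. -/
noncomputable def mapSumZero (σ : B ≃+ B) : sumZero B ≃+ sumZero B where
  toFun a := ⟨Finsupp.mapRange.addEquiv σ a.1, by
    have h := a.2
    rw [mem_sumZero] at h ⊢
    rw [sum_mapRange_addEquiv, h, map_zero]⟩
  invFun a := ⟨Finsupp.mapRange.addEquiv σ.symm a.1, by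
    have h := a.2
    rw [mem_sumZero] at h ⊢
    rw [sum_mapRange_addEquiv, h, map_zero]⟩
  left_inv a := Subtype.ext (by ext; simp)
  right_inv a := Subtype.ext (by ext; simp)
  map_add' a b := Subtype.ext (map_add _ _ _)

theorem mapSumZero_apply (σ : B ≃+ B) (a : sumZero B) (x : Fin 2 → ℤ) :
    (mapSumZero σ a).1 x = σ (a.1 x) := rfl

theorem mapSumZero_edge (σ : B ≃+ B) (b : B) (x y : Fin 2 → ℤ) :
    mapSumZero σ (edge b x y) = edge (σ b) x y := by
  apply Subtype.ext
  ext z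
  rw [mapSumZero_apply, edge_apply, edge_apply, map_sub]
  split_ifs <;> simp

theorem flux_mapSumZero {p : B →+ ℤ} {σ : B ≃+ B} (hσ : ∀ b, p (σ b) = p b) (v : Fin 2 → ℤ)
    (a : sumZero B) : flux p v (mapSumZero σ a) = flux p v a := by
  refine DFunLike.congr_fun (f := (flux p v).comp (mapSumZero σ).toAddMonoidHom) (g := flux p v)
    (sumZero_hom_ext fun b x y => ?_) a
  simp [mapSumZero_edge, flux_edge, hσ]

theorem edge_injective {x y : Fin 2 → ℤ} (h : x ≠ y) : Function.Injective fun b : B => edge b x y := by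
  intro b b' hb
  have := congrArg (fun a : sumZero B => a.1 x) hb
  simpa [edge_apply, h.symm] using this

/-- A relation on `ℤ²` that holds between neighbouring points holds everywhere. -/
theorem rel_of_neighbours {r : (Fin 2 → ℤ) → (Fin 2 → ℤ) → Prop} (hr : Equivalence r)
    (h₁ : ∀ m n : ℤ, r ![m, n] ![m + 1, n]) (h₂ : ∀ m n : ℤ, r ![m, n] ![m, n + 1])
    (x y : Fin 2 → ℤ) : r x y := by
  have a₁ : ∀ n m : ℤ, r ![m, n] ![0, n] := by
    intro n m
    induction m using Int.induction_on with
    | zero => exact hr.refl _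
    | succ i hi => exact hr.trans (hr.symm (h₁ _ _)) hi
    | pred i hi =>
      have := h₁ (-(i : ℤ) - 1) n
      rw [sub_add_cancel] at this
      exact hr.trans this hi
  have a₂ : ∀ n : ℤ, r ![0, n] ![0, 0] := by
    intro n
    induction n using Int.induction_on with
    | zero => exact hr.refl _
    | succ i hi => exact hr.trans (hr.symm (h₂ _ _)) hi
    | pred i hi =>
      have := h₂ 0 (-(i : ℤ) - 1)
      rw [sub_add_cancel] at this
      exact hr.trans this hi
  have a₃ : ∀ z : Fin 2 → ℤ, r z ![0, 0] := by
    intro z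
    have : z = ![z 0, z 1] := by ext i; fin_cases i <;> rfl
    rw [this]
    exact hr.trans (a₁ _ _) (a₂ _)
  exact hr.trans (a₃ x) (hr.symm (a₃ y))

variable {X : Type*} [MeasurableSpace X] {μ : Measure X}

theorem FourierModel.char_neg {A : Type*} [AddCommGroup A] (M : FourierModel A μ) (a : A) :
    M.char (-a) = star (M.char a) := by
  apply Lp.ext
  filter_upwards [M.coeFn_char (-a), M.coeFn_char a, Lp.coeFn_star (M.char a)] with x h1 h2 h3
  rw [h1, h3, Pi.star_apply, h2, M.u_neg, Circle.coe_inv_eq_conj, Complex.star_def]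

variable [StandardBorelSpace X] [Countable B] (M : FourierModel (sumZero B) μ)

/-- Automorphisms are multiplicative and *-preserving, so the elements a on whose characters they
agree form a subgroup. -/
theorem aut_ext_edge {α α' : AutLinfty μ}
    (h : ∀ b x, α (M.char (edge b x 0)) = α' (M.char (edge b x 0))) : α = α' := by
  let K : AddSubgroup (sumZero B) :=
    { carrier := {a | α (M.char a) = α' (M.char a)}
      zero_mem' := by
        change α (M.char 0) = α' (M.char 0)
        rw [M.char_zero, map_oneLinfty, map_oneLinfty]
      add_mem' := fun {a b} ha hb => by
        change α (M.char (a + b)) = α' (M.char (a + b))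
        rw [M.char_add, map_mul, map_mul, show α (M.char a) = _ from ha,
          show α (M.char b) = _ from hb]
      neg_mem' := fun {a} ha => by
        change α (M.char (-a)) = α' (M.char (-a))
        rw [M.char_neg, map_star, map_star, show α (M.char a) = _ from ha] }
  have : Countable (sumZero B) := inferInstance
  exact M.aut_ext fun a => edge_mem_induction K h a

variable {p : B →+ ℤ} {t : Circle}

/-- Automorphisms of the coefficient group that preserve the twist commute with the action. -/
theorem affineAut_mapSumZero_commute {σ : B ≃+ B} (hσ : ∀ b, p (σ b) = p b) (g : Z2SL2) :
    M.affineAut (mapSumZero σ) 1 * twistedAction M p t g =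
      twistedAction M p t g * M.affineAut (mapSumZero σ) 1 := by
  have : Countable (sumZero B) := inferInstance
  refine M.aut_ext fun a => ?_
  have hc : mapSumZero σ (permSumZero (affAct g) a) = permSumZero (affAct g) (mapSumZero σ a) :=
    Subtype.ext (Finsupp.ext fun _ => rfl)
  rw [StarAlgEquiv.mul_apply, StarAlgEquiv.mul_apply, twistedAction_char, M.affineAut_char, map_smul,
    M.affineAut_char, MonoidHom.one_apply, MonoidHom.one_apply, Circle.coe_one, one_smul, one_smul,
    twistedAction_char, ← hc, flux_mapSumZero hσ]

variable [IsProbabilityMeasure μ]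

/-- Infinite order of t turns the equality of squares into p b' = p b, whence all scalars are 1.
Translations then reach every horizontal unit edge, quarter turns every vertical one, and paths of
unit edges give the rest. -/
theorem intertwiner_char_edge_eq (ht : ∀ n : ℤ, t ^ n = 1 → n = 0) {π : AutLinfty μ}
    (h : ∀ g f, π (twistedAction M p t g f) = twistedAction M p t g (π f)) (b : B) :
    ∃ b', p b' = p b ∧ ∀ x y, π (M.char (edge b x y)) = M.char (edge b' x y) := by
  obtain ⟨b', l, hl, hb⟩ := intertwiner_char_edge M h b
  obtain ⟨h1, h2⟩ := intertwiner_scalar M h hl hb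
  have hp : p b' = p b := by
    have : t ^ (p b * 2 - p b' * 2) = 1 := by
      rw [_root_.zpow_sub, _root_.zpow_mul, _root_.zpow_mul]
      exact mul_inv_eq_one.2 (by exact_mod_cast h2)
    have := ht _ this
    omega
  refine ⟨b', hp, ?_⟩
  rw [hp, inv_mul_cancel, Circle.coe_one] at h1
  have gen := intertwiner_char_edge_affElt M h hb
  simp only [h1, hp, mul_inv_cancel, Circle.coe_one, mul_one, one_smul] at gen
  refine rel_of_neighbours ⟨fun x => ?_, fun {x y} hxy => ?_, fun {x y z} hxy hyz => ?_⟩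
    (fun m n => ?_) fun m n => ?_
  · have hx : ∀ c : B, edge c x x = 0 := fun c => Subtype.ext (sub_self _)
    rw [hx, hx, M.char_zero, map_oneLinfty]
  · rw [← neg_edge b x y, ← neg_edge b' x y, M.char_neg, M.char_neg, map_star, hxy]
  · rw [← edge_add_edge b x y z, ← edge_add_edge b' x y z, M.char_add, M.char_add, map_mul, hxy, hyz]
  · have := gen (affElt 1 0 0 1 (by norm_num) m n)
    simpa [affAct_affElt, add_comm] using this
  · have := gen (affElt 0 (-1) 1 0 (by norm_num) m n)
    simpa [affAct_affElt, add_comm] using this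

/-- An automorphism commuting with the twisted action is induced by an automorphism of the
coefficient group. -/
theorem exists_addEquiv_of_commute (ht : ∀ n : ℤ, t ^ n = 1 → n = 0) {π : AutLinfty μ}
    (h : ∀ g f, π (twistedAction M p t g f) = twistedAction M p t g (π f)) :
    ∃ σ : B ≃+ B, (∀ b, p (σ b) = p b) ∧
      ∀ b x y, π (M.char (edge b x y)) = M.char (edge (σ b) x y) := by
  have h' : ∀ g f, π.symm (twistedAction M p t g f) = twistedAction M p t g (π.symm f) := by
    intro g f
    rw [← StarAlgEquiv.symm_apply_apply π (twistedAction M p t g (π.symm f)), h,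
      StarAlgEquiv.apply_symm_apply]
  choose σ hσp hσ using intertwiner_char_edge_eq M ht h
  choose τ hτp hτ using intertwiner_char_edge_eq M ht h'
  have n1 : (0 : Fin 2 → ℤ) ≠ ![1, 0] := fun h0 => by simpa using congrFun h0 0
  have inj : ∀ {b b' : B}, M.char (edge b 0 ![1, 0]) = M.char (edge b' 0 ![1, 0]) → b = b' :=
    fun hb => edge_injective n1 (M.char_injective hb)
  refine ⟨⟨⟨σ, τ, fun b => inj ?_, fun b => inj ?_⟩, fun b b' => inj ?_⟩, hσp, hσ⟩
  · rw [← hτ, ← hσ, StarAlgEquiv.symm_apply_apply]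
  · rw [← hσ, ← hτ, StarAlgEquiv.apply_symm_apply]
  · rw [← hσ, edge_add, edge_add, M.char_add, M.char_add, map_mul, hσ, hσ]

end General

/-! ### The holomorph of `H` as a group of automorphisms of `ℤ × H` -/

section Holomorph

variable {H : Type*} [CommGroup H]

/-- The action of the holomorph of `H` on `ℤ × H`. -/
def holAut (x : Hol H) : (ℤ × Additive H) ≃+ (ℤ × Additive H) where
  toFun b := (b.1, b.1 • Additive.ofMul x.left + Additive.ofMul (x.right b.2.toMul))
  invFun b := (b.1, Additive.ofMul
    (x.right.symm (b.2 - b.1 • Additive.ofMul x.left).toMul))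
  left_inv b := by simp
  right_inv b := by simp
  map_add' b c := by
    refine Prod.ext rfl ?_
    simp only [Prod.fst_add, Prod.snd_add, toMul_add, map_mul, ofMul_mul, add_smul]
    abel

theorem holAut_apply (x : Hol H) (b : ℤ × Additive H) :
    holAut x b = (b.1, b.1 • Additive.ofMul x.left + Additive.ofMul (x.right b.2.toMul)) := rfl

theorem holAut_mul (x y : Hol H) (b : ℤ × Additive H) : holAut (x * y) b = holAut x (holAut y b) := by
  simp only [holAut_apply, SemidirectProduct.mul_left, SemidirectProduct.mul_right, MonoidHom.id_apply,
    ofMul_mul, toMul_add, map_mul, MulAut.mul_apply, toMul_ofMul, toMul_zsmul, map_zpow, ofMul_zpow,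
    smul_add, add_assoc]

theorem holAut_left (x : Hol H) : (holAut x (1, 0)).2.toMul = x.left := by
  simp [holAut_apply]

theorem holAut_right (x : Hol H) (h : H) : (holAut x (0, Additive.ofMul h)).2.toMul = x.right h := by
  simp [holAut_apply]

theorem holAut_injective : Function.Injective (holAut : Hol H → _) := fun x y h =>
  SemidirectProduct.ext (by rw [← holAut_left, h, holAut_left])
    (MulEquiv.ext fun k => by rw [← holAut_right, h, holAut_right])

/-- An automorphism over ℤ is determined by the H-component of the image of (1, 0) and by its
restriction to the kernel 0 × H. -/
theorem exists_holAut (σ : (ℤ × Additive H) ≃+ (ℤ × Additive H)) (hσ : ∀ b, (σ b).1 = b.1) :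
    ∃ x : Hol H, holAut x = σ := by
  have hσ' : ∀ b, (σ.symm b).1 = b.1 := fun b => by
    rw [← hσ (σ.symm b), AddEquiv.apply_symm_apply]
  have e1 : ∀ k : Additive H, σ (0, k) = (0, (σ (0, k)).2) := fun k => Prod.ext (hσ _) rfl
  have e2 : ∀ k : Additive H, σ.symm (0, k) = (0, (σ.symm (0, k)).2) := fun k => Prod.ext (hσ' _) rfl
  let θ : MulAut H :=
    { toFun := fun k => (σ (0, Additive.ofMul k)).2.toMul
      invFun := fun k => (σ.symm (0, Additive.ofMul k)).2.toMul
      left_inv := fun k => by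
        change (σ.symm (0, (σ (0, Additive.ofMul k)).2)).2.toMul = k
        rw [← e1, AddEquiv.symm_apply_apply]; rfl
      right_inv := fun k => by
        change (σ (0, (σ.symm (0, Additive.ofMul k)).2)).2.toMul = k
        rw [← e2, AddEquiv.apply_symm_apply]; rfl
      map_mul' := fun k l => by
        have : ((0 : ℤ), Additive.ofMul (k * l)) = (0, Additive.ofMul k) + (0, Additive.ofMul l) := by
          simp
        rw [this, map_add]; rfl }
  refine ⟨⟨(σ (1, 0)).2.toMul, θ⟩, AddEquiv.ext fun b => ?_⟩
  have hb : b = b.1 • ((1 : ℤ), (0 : Additive H)) + (0, b.2) := by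
    refine Prod.ext ?_ ?_ <;> simp
  refine Prod.ext (hσ b).symm ?_
  conv_rhs => rw [hb, map_add, map_zsmul]
  rfl

/-- The topology is that of pointwise convergence on the discrete group ℤ × H: evaluation at (1, 0)
reads off the H-part, evaluation at (0, k) the value at k of the automorphism part. -/
theorem hol_tendsto_iff {Y : Type*} {l : Filter Y} {f : Y → Hol H} {x : Hol H} :
    Tendsto f l (𝓝 x) ↔ ∀ b, ∀ᶠ y in l, holAut (f y) b = holAut x b := by
  let : TopologicalSpace H := ⊥
  have : DiscreteTopology H := ⟨rfl⟩
  rw [nhds_induced, tendsto_comap_iff, Prod.tendsto_iff, tendsto_pi_nhds]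
  simp only [nhds_discrete, tendsto_pure, Function.comp_apply]
  constructor
  · rintro ⟨h1, h2⟩ b
    filter_upwards [h1, h2 b.2.toMul] with y h3 h4
    rw [holAut_apply, holAut_apply, h3, h4]
  · intro h
    refine ⟨?_, fun k => ?_⟩
    · filter_upwards [h (1, 0)] with y hy
      rw [← holAut_left, hy, holAut_left]
    · filter_upwards [h (0, Additive.ofMul k)] with y hy
      rw [← holAut_right, hy, holAut_right]

end Holomorph

end Centralizer

/-! ### The centralizer as a topological group -/

section HolCentralizer

open Set Filter Matrix Topology

instance {H : Type*} [Countable H] : Countable (Additive H) := ‹Countable H›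

variable {H : Type*} [CommGroup H] {X : Type*} [MeasurableSpace X] {μ : Measure X}
  (M : FourierModel (sumZero (ℤ × Additive H)) μ)

/-- The automorphism of `L^∞` induced by an element of the holomorph. -/
noncomputable def holAffine (x : Hol H) : AutLinfty μ := M.affineAut (mapSumZero (holAut x)) 1

theorem holAffine_char (x : Hol H) (a : sumZero (ℤ × Additive H)) :
    holAffine M x (M.char a) = M.char (mapSumZero (holAut x) a) := by
  rw [holAffine, M.affineAut_char, MonoidHom.one_apply, Circle.coe_one, one_smul]

theorem mem_centralizer_iff {G : Type*} [Group G] {β : G →* AutLinfty μ} {α : AutLinfty μ} :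
    α ∈ Centralizer β ↔ ∀ g f, α (β g f) = β g (α f) := by
  rw [Centralizer, Subgroup.mem_centralizer_iff, Set.forall_mem_range]
  exact forall_congr' fun g => ⟨fun h f => (DFunLike.congr_fun h f).symm,
    fun h => StarAlgEquiv.ext fun f => (h f).symm⟩

/-- For distinct characters, pairing the difference with the unit vector u_a gives 1, so the
distance is at least 1. Convergence among characters thus means eventual equality. -/
theorem norm_toL2_char_sub [IsProbabilityMeasure μ] {A : Type*} [AddCommGroup A] (M : FourierModel A μ) {a b : A}
    (h : ‖toL2 (M.char a) - toL2 (M.char b)‖ < 1) : a = b := by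
  by_contra hab
  have h1 : inner ℂ (toL2 (M.char a)) (toL2 (M.char a) - toL2 (M.char b)) = 1 := by
    classical
    have h2 := M.coef_char a a
    have h3 := M.coef_char a b
    rw [FourierModel.coef, if_pos rfl] at h2
    rw [FourierModel.coef, if_neg hab] at h3
    rw [inner_sub_right, h2, h3, sub_zero]
  have h2 := norm_inner_le_norm (𝕜 := ℂ) (toL2 (M.char a)) (toL2 (M.char a) - toL2 (M.char b))
  rw [h1, M.orthonormal_char.1 a, norm_one, one_mul] at h2
  exact absurd h (not_lt.2 h2)

/-- The isometry of `L²` induced by an element of the holomorph. -/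
noncomputable def holIsometry (x : Hol H) : Lp ℂ 2 μ →ₗᵢ[ℂ] Lp ℂ 2 μ :=
  Lp.compMeasurePreservingₗᵢ ℂ _ (M.measurePreserving_affineEquiv (mapSumZero (holAut x)) 1)

theorem holIsometry_toL2 [IsProbabilityMeasure μ] (x : Hol H) (f : Lp ℂ ∞ μ) :
    holIsometry M x (toL2 f) = toL2 (holAffine M x f) := by
  have hR := M.measurePreserving_affineEquiv (mapSumZero (holAut x)) 1
  apply Lp.ext
  filter_upwards [Lp.coeFn_compMeasurePreserving (toL2 f) hR,
    hR.quasiMeasurePreserving.ae_eq_comp (FourierModel.coeFn_toL2 f),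
    FourierModel.coeFn_toL2 (holAffine M x f), coeFn_compAut _ hR f] with z h1 h2 h3 h4
  exact h1.trans (h2.trans (h3.trans h4).symm)

/-- On a character the map is locally constant, since only the finitely many values of a matter.
Density of the span and the isometry property extend continuity uniformly to all of L². -/
theorem continuous_holIsometry_apply [IsProbabilityMeasure μ] (g : Lp ℂ 2 μ) :
    Continuous fun x : Hol H => holIsometry M x g := by
  have hspan : ∀ g ∈ Submodule.span ℂ (range fun a => toL2 (M.char a)),
      Continuous fun x : Hol H => holIsometry M x g := by
    intro g hg
    induction hg using Submodule.span_induction with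
    | zero => simpa using continuous_const
    | add u v _ _ hu hv => simp only [map_add]; exact hu.add hv
    | smul c u _ hu => simp only [map_smul]; exact hu.const_smul c
    | mem u hu =>
      obtain ⟨a, rfl⟩ := hu
      refine continuous_iff_continuousAt.2 fun x => ?_
      have hx : Tendsto (fun y : Hol H => y) (𝓝 x) (𝓝 x) := tendsto_id
      rw [hol_tendsto_iff] at hx
      have hev : ∀ᶠ y in 𝓝 x, ∀ z ∈ a.1.support, holAut y (a.1 z) = holAut x (a.1 z) :=
        (Filter.eventually_all_finset _).2 fun z _ => hx (a.1 z)
      refine tendsto_const_nhds.congr' ?_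
      filter_upwards [hev] with y hy
      simp only [holIsometry_toL2, holAffine_char]
      congr 2
      refine Subtype.ext (Finsupp.ext fun z => ?_)
      rw [mapSumZero_apply, mapSumZero_apply]
      by_cases hz : z ∈ a.1.support
      · exact (hy z hz).symm
      · rw [Finsupp.notMem_support_iff.1 hz, map_zero, map_zero]
  refine continuous_of_uniform_approx_of_continuous fun U hU => ?_
  obtain ⟨ε, hε, hU⟩ := Metric.mem_uniformity_dist.1 hU
  have hd : Dense (Submodule.span ℂ (range fun a => toL2 (M.char a)) : Set (Lp ℂ 2 μ)) := by
    simpa only [← M.basis_apply] using Submodule.dense_iff_topologicalClosure_eq_top.2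
      M.basis.dense_span
  obtain ⟨v, hv, hgv⟩ := hd.exists_dist_lt g hε
  refine ⟨_, hspan v hv, fun x => hU ?_⟩
  rwa [(holIsometry M x).dist_map]

variable [Countable H] [StandardBorelSpace X]

/-- The homomorphism from the holomorph of `H` to the centralizer of the twisted action. -/
noncomputable def holCentralizer (t : Circle) :
    Hol H →* Centralizer (twistedAction M (AddMonoidHom.fst ℤ (Additive H)) t) :=
  MonoidHom.mk' (fun x => ⟨holAffine M x, mem_centralizer_iff.2 fun g f => DFunLike.congr_fun
    (affineAut_mapSumZero_commute M (fun _ => rfl) g) f⟩) fun x y => Subtype.ext (by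
      have : Countable (sumZero (ℤ × Additive H)) := inferInstance
      refine M.aut_ext fun a => ?_
      change holAffine M (x * y) (M.char a) = holAffine M x (holAffine M y (M.char a))
      rw [holAffine_char, holAffine_char, holAffine_char]
      congr 1
      exact Subtype.ext (Finsupp.ext fun z => holAut_mul x y _))

theorem holCentralizer_apply (t : Circle) (x : Hol H) :
    (holCentralizer M t x : AutLinfty μ) = holAffine M x := rfl

theorem zero_ne_vec : (0 : Fin 2 → ℤ) ≠ ![1, 0] := fun h0 => by simpa using congrFun h0 0

variable [IsProbabilityMeasure μ]

theorem holCentralizer_bijective {t : Circle} (ht : ∀ n : ℤ, t ^ n = 1 → n = 0) :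
    Function.Bijective (holCentralizer M t) := by
  constructor
  · intro x y hxy
    refine holAut_injective (AddEquiv.ext fun b => edge_injective zero_ne_vec (M.char_injective ?_))
    have h1 : holAffine M x = holAffine M y := congrArg Subtype.val hxy
    change M.char (edge (holAut x b) 0 ![1, 0]) = M.char (edge (holAut y b) 0 ![1, 0])
    rw [← mapSumZero_edge, ← holAffine_char, h1, holAffine_char, mapSumZero_edge]
  · rintro ⟨α, hα⟩
    obtain ⟨σ, hσp, hσ⟩ := exists_addEquiv_of_commute M ht (mem_centralizer_iff.1 hα)
    obtain ⟨x, rfl⟩ := exists_holAut σ hσp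
    refine ⟨x, Subtype.ext (aut_ext_edge M fun b z => ?_)⟩
    rw [holCentralizer_apply, holAffine_char, mapSumZero_edge, hσ]

theorem continuous_holCentralizer (t : Circle) : Continuous (holCentralizer M t) := by
  refine continuous_induced_rng.2 (continuous_pi fun f => ?_)
  change Continuous fun x : Hol H => toL2 (holAffine M x f)
  have := continuous_holIsometry_apply M (toL2 f)
  simpa only [holIsometry_toL2] using this

/-- The centralizer of the twisted action is isomorphic to the holomorph of `H`. -/
theorem nonempty_centralizer_equiv {t : Circle} (ht : ∀ n : ℤ, t ^ n = 1 → n = 0) :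
    Nonempty (Centralizer (twistedAction M (AddMonoidHom.fst ℤ (Additive H)) t) ≃ₜ* Hol H) := by
  let e := MulEquiv.ofBijective (holCentralizer M t) (holCentralizer_bijective M ht)
  refine ⟨ContinuousMulEquiv.symm ⟨e, continuous_holCentralizer M t, ?_⟩⟩
  refine continuous_iff_continuousAt.2 fun α => hol_tendsto_iff.2 fun b => ?_
  change ∀ᶠ γ in 𝓝 α, holAut (e.symm γ) b = holAut (e.symm α) b
  -- The orbit of an edge character consists of characters, so a 2-norm distance below 1 already
  -- fixes the value of the group element at b.
  have key : ∀ γ : Centralizer (twistedAction M (AddMonoidHom.fst ℤ (Additive H)) t),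
      toL2 ((γ : AutLinfty μ) (M.char (edge b 0 ![1, 0]))) =
        toL2 (M.char (edge (holAut (e.symm γ) b) 0 ![1, 0])) := by
    intro γ
    conv_lhs => rw [← e.apply_symm_apply γ]
    change toL2 (holAffine M (e.symm γ) _) = _
    rw [holAffine_char, mapSumZero_edge]
  have hc0 : Continuous fun (γ : Centralizer (twistedAction M (AddMonoidHom.fst ℤ (Additive H)) t))
      (f : Lp ℂ ∞ μ) => toL2 ((γ : AutLinfty μ) f) := continuous_induced_dom
  have hc : Continuous fun γ : Centralizer (twistedAction M (AddMonoidHom.fst ℤ (Additive H)) t) =>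
      toL2 ((γ : AutLinfty μ) (M.char (edge b 0 ![1, 0]))) :=
    (continuous_apply (M.char (edge b 0 ![1, 0]))).comp hc0
  have hev := (hc.continuousAt (x := α)).eventually (Metric.ball_mem_nhds _ one_pos)
  filter_upwards [hev] with γ hγ
  simp only [dist_eq_norm, key] at hγ
  exact edge_injective zero_ne_vec (norm_toL2_char_sub M hγ)

/-- Conjugate twisted actions have related parameters. -/
theorem exists_zpow_of_isConjugate {B : Type*} [AddCommGroup B] [Countable B]
    (M : FourierModel (sumZero B) μ) {p : B →+ ℤ} {t t' : Circle}
    (h : IsConjugate (twistedAction M p t) (twistedAction M p t')) {b : B} (hb : p b = 1) :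
    ∃ k : ℤ, t ^ 2 = (t' ^ k) ^ 2 := by
  obtain ⟨π, hπ⟩ := h
  obtain ⟨b', l, hl, hc⟩ := intertwiner_char_edge M hπ b
  refine ⟨p b', ?_⟩
  rw [← (intertwiner_scalar M hπ hl hc).2, hb, zpow_one]

end HolCentralizer

theorem IsConjugate.symm {X : Type*} [MeasurableSpace X] {μ : Measure X} {G : Type*} [Group G]
    {β₁ β₂ : G →* AutLinfty μ} (h : IsConjugate β₁ β₂) : IsConjugate β₂ β₁ := by
  obtain ⟨π, hπ⟩ := h
  refine ⟨π.symm, fun g f => ?_⟩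
  rw [← StarAlgEquiv.symm_apply_apply π (β₁ g (π.symm f)), hπ, StarAlgEquiv.apply_symm_apply]

/-! ### The family of actions -/

section Parameters

open Set

/-- The parameters of the family of actions. -/
def irrationalAngles : Set ℝ := {θ | θ ∈ Ioo (0 : ℝ) (1 / 4) ∧ Irrational θ}

/-- The point of the circle of angle `2πθ`. -/
noncomputable def anglePoint (θ : ℝ) : Circle := Circle.exp (2 * Real.pi * θ)

theorem anglePoint_zpow_eq_iff {θ θ' : ℝ} {m n : ℤ} :
    anglePoint θ ^ m = anglePoint θ' ^ n ↔ ∃ k : ℤ, m * θ = n * θ' + k := by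
  rw [anglePoint, anglePoint, ← Circle.exp_intCast_mul, ← Circle.exp_intCast_mul, Circle.exp_eq_exp]
  have := Real.pi_pos
  refine exists_congr fun k => ⟨fun h => ?_, fun h => ?_⟩
  · have h2 : (2 * Real.pi) * (m * θ) = (2 * Real.pi) * (n * θ' + k) := by linear_combination h
    exact mul_left_cancel₀ (by positivity) h2
  · linear_combination (2 * Real.pi) * h

theorem anglePoint_zpow_eq_one {θ : ℝ} (hθ : Irrational θ) (n : ℤ) (h : anglePoint θ ^ n = 1) :
    n = 0 := by
  rw [← zpow_zero (anglePoint 0), anglePoint_zpow_eq_iff] at h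
  obtain ⟨k, hk⟩ := h
  by_contra hn
  exact (hθ.intCast_mul hn).ne_int k (by simpa using hk)

/-- Substituting one relation into the other gives k k' = 1 by irrationality. For k = 1 the integer
2θ − 2θ' has modulus below 1/2, hence is 0; for k = −1 the integer 2θ + 2θ' would lie strictly
between 0 and 1. -/
theorem eq_of_anglePoint_sq {θ θ' : ℝ} (hθ : θ ∈ irrationalAngles) (hθ' : θ' ∈ irrationalAngles)
    {k k' : ℤ} (h : anglePoint θ ^ 2 = (anglePoint θ' ^ k) ^ 2)
    (h' : anglePoint θ' ^ 2 = (anglePoint θ ^ k') ^ 2) : θ = θ' := by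
  have aux : ∀ {s s' : ℝ} {j : ℤ}, anglePoint s ^ 2 = (anglePoint s' ^ j) ^ 2 →
      ∃ m : ℤ, 2 * s = 2 * j * s' + m := by
    intro s s' j hs
    have h1 : anglePoint s ^ (2 : ℤ) = anglePoint s' ^ (j * 2) := by
      rw [zpow_mul]; exact_mod_cast hs
    obtain ⟨m, hm⟩ := anglePoint_zpow_eq_iff.1 h1
    refine ⟨m, ?_⟩
    push_cast at hm
    linarith
  obtain ⟨m, hm⟩ := aux h
  obtain ⟨m', hm'⟩ := aux h'
  have hkk : k * k' = 1 := by
    by_contra hne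
    have h1 : (2 * (1 - k * k') : ℤ) ≠ 0 := by omega
    refine (hθ.2.intCast_mul h1).ne_int (k * m' + m) ?_
    push_cast
    linear_combination hm + k * hm'
  obtain ⟨⟨a1, a2⟩, -⟩ := hθ
  obtain ⟨⟨b1, b2⟩, -⟩ := hθ'
  rcases Int.mul_eq_one_iff_eq_one_or_neg_one.1 hkk with ⟨rfl, -⟩ | ⟨rfl, -⟩
  · have h1 : (m : ℝ) < 1 := by push_cast at hm; linarith
    have h2 : (-1 : ℝ) < m := by push_cast at hm; linarith
    have h3 : m = 0 := by
      have : m < 1 := by exact_mod_cast h1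
      have : -1 < m := by exact_mod_cast h2
      omega
    rw [h3] at hm
    push_cast at hm
    linarith
  · have h1 : (m : ℝ) < 1 := by push_cast at hm; linarith
    have h2 : (0 : ℝ) < m := by push_cast at hm; linarith
    have : m < 1 := by exact_mod_cast h1
    have : 0 < m := by exact_mod_cast h2
    omega

theorem mk_irrationalAngles : Cardinal.mk irrationalAngles = Cardinal.continuum := by
  refine le_antisymm ((Cardinal.mk_set_le _).trans_eq Cardinal.mk_real) ?_
  by_contra hlt
  rw [not_le] at hlt
  -- The interval has cardinality continuum, and the rationals account for only countably many of
  -- its points.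
  have hsub : Ioo (0 : ℝ) (1 / 4) ⊆ irrationalAngles ∪ range ((↑) : ℚ → ℝ) := fun θ hθ => by
    by_cases h : Irrational θ
    · exact Or.inl ⟨hθ, h⟩
    · exact Or.inr (not_not.1 h)
  have h1 := Cardinal.mk_le_mk_of_subset hsub
  rw [Cardinal.mk_Ioo_real (by norm_num)] at h1
  refine absurd (h1.trans (Cardinal.mk_union_le _ _)) (not_le.2 ?_)
  refine Cardinal.add_lt_of_lt Cardinal.aleph0_le_continuum hlt ?_
  exact (Cardinal.mk_le_aleph0_iff.2 (countable_range _).to_subtype).trans_lt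
    Cardinal.aleph0_lt_continuum

end Parameters

/-- The twisted actions with irrational parameters have all the required properties. -/
theorem exists_twistedActions {X : Type*} [MeasurableSpace X] [StandardBorelSpace X]
    (μ : Measure X) [IsProbabilityMeasure μ] [NullSingletonClass μ]
    (H : Type*) [CommGroup H] [Countable H] :
    ∃ S : Set (Z2SL2 →* AutLinfty μ),
      Cardinal.mk S = Cardinal.continuum ∧
      (∀ β ∈ S,
        IsTracePreserving β ∧
        IsEssentiallyFree β ∧
        IsErgodicAction β ∧
        Nonempty (Centralizer β ≃ₜ* Hol H)) ∧
      (∀ β₁ ∈ S, ∀ β₂ ∈ S, β₁ ≠ β₂ → ¬ IsConjugate β₁ β₂) := by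
  have : Countable (sumZero (ℤ × Additive H)) := inferInstance
  have hb : ∀ n : ℕ, n ≠ 0 → n • ((1 : ℤ), (0 : Additive H)) ≠ 0 := fun n hn h =>
    hn (by simpa using congrArg Prod.fst h)
  obtain ⟨M⟩ := nonempty_fourierModel μ (edge ((1 : ℤ), (0 : Additive H)) 0 ![1, 0]) fun n hn h => by
    have h1 : n • (edge ((1 : ℤ), (0 : Additive H)) 0 ![1, 0]).1 0 = 0 :=
      congrArg (fun a : sumZero (ℤ × Additive H) => a.1 0) h
    rw [edge_apply, if_pos rfl, if_neg zero_ne_vec.symm, sub_zero] at h1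
    exact hb n hn h1
  set p := AddMonoidHom.fst ℤ (Additive H)
  have hinj : ∀ θ ∈ irrationalAngles, ∀ θ' ∈ irrationalAngles,
      IsConjugate (twistedAction M p (anglePoint θ)) (twistedAction M p (anglePoint θ')) →
        θ = θ' := by
    intro θ hθ θ' hθ' h
    obtain ⟨k, hk⟩ := exists_zpow_of_isConjugate M h (b := (1, 0)) rfl
    obtain ⟨k', hk'⟩ := exists_zpow_of_isConjugate M h.symm (b := (1, 0)) rfl
    exact eq_of_anglePoint_sq hθ hθ' hk hk'
  refine ⟨Set.range fun θ : irrationalAngles => twistedAction M p (anglePoint θ), ?_, ?_, ?_⟩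
  -- Equal actions are conjugate by the identity, so non-conjugacy already makes the parametrisation
  -- injective.
  · have := Cardinal.mk_range_eq_of_injective
      (f := fun θ : irrationalAngles => twistedAction M p (anglePoint θ)) fun θ θ' h =>
        Subtype.ext (hinj θ θ.2 θ' θ'.2 ⟨1, fun g f => congrArg (fun β => β g f) h⟩)
    rw [mk_irrationalAngles, Cardinal.lift_continuum] at this
    simpa using this
  · rintro - ⟨θ, rfl⟩
    exact ⟨isTracePreserving_twistedAction M p _, isEssentiallyFree_twistedAction M p _ (1, 0) hb,
      isErgodicAction_twistedAction M p _,
      nonempty_centralizer_equiv M (anglePoint_zpow_eq_one θ.2.2)⟩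
  · rintro - ⟨θ, rfl⟩ - ⟨θ', rfl⟩ hne h
    obtain rfl : θ = θ' := Subtype.ext (hinj θ θ.2 θ' θ'.2 h)
    exact hne rfl

end TwistedBernoulli

theorem corollary5p3 {X : Type*} [MeasurableSpace X] [StandardBorelSpace X]
    (μ : Measure X) [IsProbabilityMeasure μ] [NullSingletonClass μ]
    (H : Type*) [CommGroup H] [Countable H] [Nontrivial H] :
    ∃ S : Set (TwistedBernoulli.Z2SL2 →* TwistedBernoulli.AutLinfty μ),
      Cardinal.mk S = Cardinal.continuum ∧
      (∀ β ∈ S,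
        TwistedBernoulli.IsTracePreserving β ∧
        TwistedBernoulli.IsEssentiallyFree β ∧
        TwistedBernoulli.IsErgodicAction β ∧
        Nonempty (TwistedBernoulli.Centralizer β ≃ₜ* TwistedBernoulli.Hol H)) ∧
      (∀ β₁ ∈ S, ∀ β₂ ∈ S, β₁ ≠ β₂ → ¬ TwistedBernoulli.IsConjugate β₁ β₂) :=
  TwistedBernoulli.exists_twistedActions μ H
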